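/- Let $(M,g)$ be a compact six-dimensional nearly Kähler manifold (without boundary), i.e. a compact Riemannian spin six-manifold whose real spinor bundle $S$ (of rank eight) carries a nowhere-vanishing section $\psi$ with $$\nabla^{LC}_X\psi=\lambda\,X\cdot\psi\qquad\text{for all vector fields }X,$$ for some real constant $\lambda\neq 0$, where $\nabla^{LC}$ is induced by the Levi-Civita connection. Let $K$ be an abelian Lie group, $\mathcal P\to M$ a smooth principal $K$-bundle with adjoint bundle $\mathrm{Ad}_{\mathcal P}$, and $A$ a connection on $\mathcal P$ whose curvature $F$ satisfies the instanton equation $F\cdot\psi=0$, where the two-form part of $F$ acts by Clifford multiplication on $\psi$. Then $A$ is rigid, that is, its space of infinitesimal deformations is zero: if $\epsilon$ is a smooth section of $T^*M\otimes\mathrm{Ad}_{\mathcal P}$ with $$\mathrm d^A\epsilon\cdot\psi=0\qquad\text{and}\qquad \mathrm d^A{*}\epsilon=0,$$ then $\epsilon=0$. -/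

import Mathlib

open Bundle
open scoped Manifold ContDiff TensorProduct

noncomputable section

/-! ### Nearly Kähler six-manifolds -/

/-- The model space of a six-manifold. -/
abbrev E6 : Type := EuclideanSpace ℝ (Fin 6)

/-- The standard fibre of the real spinor bundle of a spin six-manifold. -/
abbrev E8 : Type := EuclideanSpace ℝ (Fin 8)

section Spin

variable (M : Type*) [TopologicalSpace M] [ChartedSpace E6 M] [IsManifold (𝓡 6) ∞ M]
  [RiemannianBundle (fun x : M => TangentSpace (𝓡 6) x)]
  [IsContMDiffRiemannianBundle (𝓡 6) ∞ E6 (fun x : M => TangentSpace (𝓡 6) x)]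
  (S : M → Type*) [TopologicalSpace (Bundle.TotalSpace E8 S)]
  [∀ x, NormedAddCommGroup (S x)] [∀ x, InnerProductSpace ℝ (S x)]
  [FiberBundle E8 S] [VectorBundle ℝ E8 S] [ContMDiffVectorBundle ∞ E8 S (𝓡 6)]
  [IsContMDiffRiemannianBundle (𝓡 6) ∞ E8 S]

/-- The structure which makes a smooth real vector bundle `S` of rank eight with a fibre metric
into the real spinor bundle of an orientation and a spin structure on the Riemannian six-manifold
`M`.  Since `Cl(6)` (with `v² = -|v|²`) is isomorphic to the algebra of real `8 × 8` matrices, its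
only orthogonal representation of dimension eight is the spinor representation, and giving an
orientation, a spin structure and its real spinor bundle is the same as giving a bundle of
orthogonal eight-dimensional Clifford modules with a smoothly varying volume element. -/
structure RealSpinorBundle where
  /-- Clifford multiplication `v · s`. -/
  cl : ∀ x : M, TangentSpace (𝓡 6) x →L[ℝ] S x →L[ℝ] S x
  contMDiff_cl : ContMDiff (𝓡 6) ((𝓡 6).prod 𝓘(ℝ, E6 →L[ℝ] E8 →L[ℝ] E8)) ∞
    (fun x => Bundle.TotalSpace.mk' (E6 →L[ℝ] E8 →L[ℝ] E8) x (cl x))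
  cl_cl : ∀ (x : M) (v : TangentSpace (𝓡 6) x) (s : S x),
    cl x v (cl x v s) = -(inner ℝ v v) • s
  cl_skew : ∀ (x : M) (v : TangentSpace (𝓡 6) x) (s t : S x),
    inner ℝ (cl x v s) t = -inner ℝ s (cl x v t)
  /-- Clifford multiplication by the volume form of the orientation. -/
  vol : ∀ x : M, S x →L[ℝ] S x
  contMDiff_vol : ContMDiff (𝓡 6) ((𝓡 6).prod 𝓘(ℝ, E8 →L[ℝ] E8)) ∞
    (fun x => Bundle.TotalSpace.mk' (E8 →L[ℝ] E8) x (vol x))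
  vol_eq : ∀ x : M, ∃ e : OrthonormalBasis (Fin 6) ℝ (TangentSpace (𝓡 6) x), ∀ s : S x,
    vol x s = cl x (e 0) (cl x (e 1) (cl x (e 2) (cl x (e 3) (cl x (e 4) (cl x (e 5) s)))))

variable {M}

set_option synthInstance.maxHeartbeats 400000 in
/-- `D` is the Levi-Civita connection: the (unique) smooth covariant derivative on `TM` which is
metric and torsion-free. -/
structure IsLeviCivita
    (D : CovariantDerivative (𝓡 6) E6 (fun x : M => TangentSpace (𝓡 6) x)) : Prop where
  smooth : CovariantDerivative.ContMDiffCovariantDerivative D ∞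
  metric : D.IsMetricCompatible
  torsion_free : D.torsion = 0

variable {S}

/-- `DS` is the spin connection induced by the connection `D` on `TM`: the (unique) smooth metric
covariant derivative on the spinor bundle with
`∇_v (X · s) = (∇_v X) · s + X · ∇_v s`. -/
structure IsSpinConnection (σ : RealSpinorBundle M S)
    (D : CovariantDerivative (𝓡 6) E6 (fun x : M => TangentSpace (𝓡 6) x))
    (DS : CovariantDerivative (𝓡 6) E8 S) : Prop where
  smooth : CovariantDerivative.ContMDiffCovariantDerivative DS ∞
  metric : DS.IsMetricCompatible
  clifford : ∀ (X : ∀ x : M, TangentSpace (𝓡 6) x) (s : ∀ x : M, S x) (x : M)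
    (v : TangentSpace (𝓡 6) x),
    MDifferentiableAt (𝓡 6) (𝓡 6).tangent
      (fun y => Bundle.TotalSpace.mk' E6 (E := fun x : M => TangentSpace (𝓡 6) x) y (X y)) x →
    MDifferentiableAt (𝓡 6) ((𝓡 6).prod 𝓘(ℝ, E8))
      (fun y => Bundle.TotalSpace.mk' E8 y (s y)) x →
    DS (fun y => σ.cl y (X y) (s y)) x v
      = σ.cl x (D X x v) (s x) + σ.cl x (X x) (DS s x v)

variable (M S)

/-- A nearly Kähler structure on the Riemannian six-manifold `M`: an orientation and a spin
structure with real spinor bundle `S`, and a nowhere vanishing real Killing spinor `ψ`, that is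
`∇_v ψ = lam • v · ψ` with a real constant `lam ≠ 0`, where `∇` is the connection on `S` induced
by the Levi-Civita connection. -/
structure NearlyKahler where
  spin : RealSpinorBundle M S
  /-- the Levi-Civita connection -/
  LC : CovariantDerivative (𝓡 6) E6 (fun x : M => TangentSpace (𝓡 6) x)
  isLeviCivita : IsLeviCivita LC
  /-- the spin connection induced by the Levi-Civita connection -/
  spinLC : CovariantDerivative (𝓡 6) E8 S
  isSpinConnection : IsSpinConnection spin LC spinLC
  /-- the Killing spinor -/
  ψ : ∀ x : M, S x
  contMDiff_ψ : ContMDiff (𝓡 6) ((𝓡 6).prod 𝓘(ℝ, E8)) ∞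
    (fun x => Bundle.TotalSpace.mk' E8 x (ψ x))
  ψ_ne_zero : ∀ x, ψ x ≠ 0
  lam : ℝ
  lam_ne_zero : lam ≠ 0
  killing : ∀ (x : M) (v : TangentSpace (𝓡 6) x), spinLC ψ x v = lam • spin.cl x v (ψ x)

end Spin

/-! ### Differential one-forms on a manifold

`P` is a boundaryless manifold modelled on the vector space `EP`, and forms take values in the
vector space `V`. -/

section Forms

variable {EP : Type*} [NormedAddCommGroup EP] [NormedSpace ℝ EP]
  {P : Type*} [TopologicalSpace P] [ChartedSpace EP P]
  {V : Type*} [NormedAddCommGroup V] [NormedSpace ℝ V]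

/-- A one-form is smooth if it is smooth as a function on the tangent bundle. -/
def SmoothOneForm [IsManifold 𝓘(ℝ, EP) ∞ P]
    (φ : ∀ p : P, TangentSpace 𝓘(ℝ, EP) p →L[ℝ] V) : Prop :=
  ContMDiff 𝓘(ℝ, EP).tangent 𝓘(ℝ, V) ∞
    (fun w : TangentBundle 𝓘(ℝ, EP) P => φ w.proj w.snd)

/-- The pull-back of a one-form to the model space by the inverse of the preferred chart at `p`. -/
def oneFormInChart (φ : ∀ p : P, TangentSpace 𝓘(ℝ, EP) p →L[ℝ] V) (p : P) (y : EP) :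
    EP →L[ℝ] V :=
  (φ ((chartAt EP p).symm y)).comp
    (mfderiv 𝓘(ℝ, EP) 𝓘(ℝ, EP) (chartAt EP p).symm y)

/-- The exterior derivative `dφ_p(u, w)` of a one-form on a manifold, computed in the preferred
chart at `p`. -/
def extDerivOneForm (φ : ∀ p : P, TangentSpace 𝓘(ℝ, EP) p →L[ℝ] V) (p : P)
    (u w : TangentSpace 𝓘(ℝ, EP) p) : V :=
  extDeriv
    (fun y : EP => ContinuousAlternatingMap.ofSubsingleton ℝ EP V (0 : Fin 1)
      (oneFormInChart φ p y))
    (chartAt EP p p)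
    ![mvfderiv 𝓘(ℝ, EP) (chartAt EP p) p u, mvfderiv 𝓘(ℝ, EP) (chartAt EP p) p w]

end Forms

/-! ### Principal bundles and connections

The structure group `K` is a Lie group modelled on `EK`; its Lie algebra is the tangent space at
the identity, which in Mathlib is the vector space `EK` itself (identified by the preferred chart at
`1`). -/

section Principal

/-- The adjoint representation: the derivative at `1` of `h ↦ k * h * k⁻¹`. -/
def adjointRep {EK : Type*} [NormedAddCommGroup EK] [NormedSpace ℝ EK]
    {K : Type*} [TopologicalSpace K] [ChartedSpace EK K] [Group K]
    (k : K) : EK →L[ℝ] EK :=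
  mfderiv 𝓘(ℝ, EK) 𝓘(ℝ, EK) (fun h : K => k * h * k⁻¹) 1

variable (M : Type*) [TopologicalSpace M] [ChartedSpace E6 M] [IsManifold (𝓡 6) ∞ M]
  (EK : Type*) [NormedAddCommGroup EK] [NormedSpace ℝ EK]
  (K : Type*) [TopologicalSpace K] [ChartedSpace EK K] [Group K] [LieGroup 𝓘(ℝ, EK) ∞ K]
  (EP : Type*) [NormedAddCommGroup EP] [NormedSpace ℝ EP]
  (P : Type*) [TopologicalSpace P] [ChartedSpace EP P] [IsManifold 𝓘(ℝ, EP) ∞ P]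

/-- A smooth principal `K`-bundle over `M` with total space `P`. -/
structure PrincipalBundle where
  proj : P → M
  contMDiff_proj : ContMDiff 𝓘(ℝ, EP) (𝓡 6) ∞ proj
  /-- the right action of the structure group -/
  act : P → K → P
  contMDiff_act : ContMDiff (𝓘(ℝ, EP).prod 𝓘(ℝ, EK)) 𝓘(ℝ, EP) ∞
    (fun q : P × K => act q.1 q.2)
  act_one : ∀ p, act p 1 = p
  act_mul : ∀ p k l, act p (k * l) = act (act p k) l
  proj_act : ∀ p k, proj (act p k) = proj p
  /-- Every point of `M` has an open neighbourhood `U` with a smooth section `s` over `U` for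
  which `(y, k) ↦ s y · k` is a diffeomorphism from `U × K` onto `π⁻¹ U`, with inverse
  `p ↦ (π p, κ p)`. -/
  locally_trivial : ∀ x : M, ∃ (U : Set M) (s : M → P) (κ : P → K),
    IsOpen U ∧ x ∈ U ∧
    ContMDiffOn (𝓡 6) 𝓘(ℝ, EP) ∞ s U ∧
    ContMDiffOn 𝓘(ℝ, EP) 𝓘(ℝ, EK) ∞ κ (proj ⁻¹' U) ∧
    (∀ y ∈ U, proj (s y) = y) ∧
    (∀ y ∈ U, ∀ k, κ (act (s y) k) = k) ∧
    (∀ p ∈ proj ⁻¹' U, act (s (proj p)) (κ p) = p)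

variable {M EK K EP P}

namespace PrincipalBundle

variable (B : PrincipalBundle M EK K EP P)

/-- The linear map `ξ ↦ ξ_P(p)` from the Lie algebra of `K` to the tangent space at `p` (the point
`B.act p 1` is `p`), where `ξ_P` is the fundamental vector field of `ξ`. -/
def fundamental (p : P) : EK →L[ℝ] TangentSpace 𝓘(ℝ, EP) p :=
  mfderiv 𝓘(ℝ, EK) 𝓘(ℝ, EP) (fun k : K => B.act p k) 1

/-- A connection on a principal bundle, as a smooth Lie algebra valued one-form on the total
space which is equivariant and reproduces the generators of the fundamental vector fields. -/
structure Connection where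
  form : ∀ p : P, TangentSpace 𝓘(ℝ, EP) p →L[ℝ] EK
  smooth : SmoothOneForm form
  equivariant : ∀ (p : P) (k : K) (u : TangentSpace 𝓘(ℝ, EP) p),
    form (B.act p k) (mfderiv 𝓘(ℝ, EP) 𝓘(ℝ, EP) (fun q => B.act q k) p u)
      = adjointRep k⁻¹ (form p u)
  vertical : ∀ (p : P) (ξ : EK), form p (B.fundamental p ξ) = ξ

/-- A smooth section of `T*M ⊗ Ad_P`, as a tensorial one-form: a smooth Lie algebra valued one-form
on `P` which is equivariant and vanishes on vertical vectors. -/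
structure AdOneForm where
  form : ∀ p : P, TangentSpace 𝓘(ℝ, EP) p →L[ℝ] EK
  smooth : SmoothOneForm form
  equivariant : ∀ (p : P) (k : K) (u : TangentSpace 𝓘(ℝ, EP) p),
    form (B.act p k) (mfderiv 𝓘(ℝ, EP) 𝓘(ℝ, EP) (fun q => B.act q k) p u)
      = adjointRep k⁻¹ (form p u)
  horizontal : ∀ (p : P) (u : TangentSpace 𝓘(ℝ, EP) p),
    mfderiv 𝓘(ℝ, EP) (𝓡 6) B.proj p u = 0 → form p u = 0

variable {B}

namespace Connection

variable (A : B.Connection)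

/-- The horizontal part `u - (A(u))_P` of a tangent vector `u` of `P` at `p`. -/
def horPart (p : P) (u : TangentSpace 𝓘(ℝ, EP) p) : TangentSpace 𝓘(ℝ, EP) p :=
  u - B.fundamental p (A.form p u)

/-- The horizontal lift at `p` of a tangent vector `v` of `M` at `π p`: the horizontal part of any
tangent vector of `P` at `p` over `v`. -/
def lift (p : P) (v : TangentSpace (𝓡 6) (B.proj p)) : TangentSpace 𝓘(ℝ, EP) p :=
  A.horPart p (Function.invFun (fun u => mfderiv 𝓘(ℝ, EP) (𝓡 6) B.proj p u) v)

/-- The exterior covariant derivative `d^A φ` of a Lie algebra valued one-form on `P`,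
`d^A φ (v, w) = dφ (v^h, w^h)` with horizontal lifts. As a horizontal form it is
given by its values on pairs of tangent vectors of `M` at `π p`. -/
def extCovDeriv (φ : ∀ p : P, TangentSpace 𝓘(ℝ, EP) p →L[ℝ] EK) (p : P)
    (v w : TangentSpace (𝓡 6) (B.proj p)) : EK :=
  extDerivOneForm φ p (A.lift p v) (A.lift p w)

/-- The curvature `F = d^A A`. -/
def curvature (p : P) (v w : TangentSpace (𝓡 6) (B.proj p)) : EK :=
  A.extCovDeriv A.form p v w

/-- `((∇_v ε)(Y))_p`, for the connection `∇` on `T*M ⊗ Ad_P` induced by a connection `D` on `TM` and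
by `A`: the derivative along the lift of `v` of the `Ad_P`-valued function `ε(Y)`, which is
`q ↦ ε_q(Y^h)`, minus `ε(D_v Y)`. -/
def covDeriv (D : CovariantDerivative (𝓡 6) E6 (fun x : M => TangentSpace (𝓡 6) x))
    (ε : B.AdOneForm) (Y : ∀ x : M, TangentSpace (𝓡 6) x) (p : P)
    (v : TangentSpace (𝓡 6) (B.proj p)) : EK :=
  mvfderiv 𝓘(ℝ, EP) (fun q : P => ε.form q (A.lift q (Y (B.proj q)))) p (A.lift p v)
  - ε.form p (A.lift p (D Y (B.proj p) v))

end Connection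

end PrincipalBundle

end Principal

/-! ### Instantons and their deformations -/

section Instanton

variable {M : Type*} [TopologicalSpace M] [ChartedSpace E6 M] [IsManifold (𝓡 6) ∞ M]
  [RiemannianBundle (fun x : M => TangentSpace (𝓡 6) x)]
  [IsContMDiffRiemannianBundle (𝓡 6) ∞ E6 (fun x : M => TangentSpace (𝓡 6) x)]
  {S : M → Type*} [TopologicalSpace (Bundle.TotalSpace E8 S)]
  [∀ x, NormedAddCommGroup (S x)] [∀ x, InnerProductSpace ℝ (S x)]
  [FiberBundle E8 S] [VectorBundle ℝ E8 S] [ContMDiffVectorBundle ∞ E8 S (𝓡 6)]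
  [IsContMDiffRiemannianBundle (𝓡 6) ∞ E8 S]
  {EK : Type*} [NormedAddCommGroup EK] [NormedSpace ℝ EK]
  {K : Type*} [TopologicalSpace K] [ChartedSpace EK K] [Group K] [LieGroup 𝓘(ℝ, EK) ∞ K]
  {EP : Type*} [NormedAddCommGroup EP] [NormedSpace ℝ EP]
  {P : Type*} [TopologicalSpace P] [ChartedSpace EP P] [IsManifold 𝓘(ℝ, EP) ∞ P]

/-- The Clifford action `β · s = ½ ∑ β(e_a, e_b) ⊗ e_a · e_b · s` of a two-form `β` with values
in a vector space `V` on a spinor `s`, in an orthonormal basis `e`. -/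
def clTwoForm {V : Type*} [NormedAddCommGroup V] [NormedSpace ℝ V]
    (σ : RealSpinorBundle M S) {x : M}
    (e : OrthonormalBasis (Fin 6) ℝ (TangentSpace (𝓡 6) x))
    (β : TangentSpace (𝓡 6) x → TangentSpace (𝓡 6) x → V) (s : S x) : V ⊗[ℝ] S x :=
  (1 / 2 : ℝ) • ∑ a, ∑ b, β (e a) (e b) ⊗ₜ[ℝ] σ.cl x (e a) (σ.cl x (e b) s)

variable (N : NearlyKahler M S) {B : PrincipalBundle M EK K EP P}

/-- The instanton equation `F · ψ = 0`. -/
def IsInstanton (A : B.Connection) : Prop :=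
  ∀ (p : P) (e : OrthonormalBasis (Fin 6) ℝ (TangentSpace (𝓡 6) (B.proj p))),
    clTwoForm N.spin e (A.curvature p) (N.ψ (B.proj p)) = 0

/-- The linearised instanton equation `d^A ε · ψ = 0`. -/
def IsLinearisedInstanton (A : B.Connection) (ε : B.AdOneForm) : Prop :=
  ∀ (p : P) (e : OrthonormalBasis (Fin 6) ℝ (TangentSpace (𝓡 6) (B.proj p))),
    clTwoForm N.spin e (A.extCovDeriv ε.form p) (N.ψ (B.proj p)) = 0

/-- The gauge-fixing condition `d^A * ε = 0`, equivalently `∑ (∇_{e_a} ε)(e_a) = 0` for every frame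
of smooth vector fields which is orthonormal at the point considered; the connection is induced by
the Levi-Civita connection and `A`. -/
def IsGaugeFixed (A : B.Connection) (ε : B.AdOneForm) : Prop :=
  ∀ (p : P) (Y : Fin 6 → ∀ x : M, TangentSpace (𝓡 6) x),
    (∀ a, ContMDiffAt (𝓡 6) (𝓡 6).tangent ∞
      (fun y => Bundle.TotalSpace.mk' E6 (E := fun x : M => TangentSpace (𝓡 6) x) y (Y a y))
      (B.proj p)) →
    Orthonormal ℝ (fun a => Y a (B.proj p)) →
    ∑ a, A.covDeriv N.LC ε (Y a) p (Y a (B.proj p)) = 0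

/-- The connection `A` is rigid (as an instanton): its space of infinitesimal deformations,
the solutions `ε` of `d^A ε · ψ = 0`, `d^A * ε = 0`, is zero. -/
def IsRigid (A : B.Connection) : Prop :=
  ∀ ε : B.AdOneForm, IsLinearisedInstanton N A ε → IsGaugeFixed N A ε →
    ∀ p, ε.form p = 0

end Instanton

end

/-!
The proof reduces the statement to a vanishing theorem for spinors on the base and proves that by a
pointwise Bochner argument.

*Descent.* As `K` is abelian, its adjoint representation is trivial, so a tensorial one-form `ε` is
the pull-back of a one-form on `M` with values in the Lie algebra
(`PrincipalBundle.AdOneForm.exists_eq_pullback`). It is enough to treat its real components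
`α = l ∘ ε`, and `A` drops out: for the vector field `X` dual to `α`, the linearised instanton
equation says `dα · ψ = 0` and the gauge-fixing condition says `div X = 0`
(`PrincipalBundle.Connection.extCovDeriv_eq`, `PrincipalBundle.Connection.covDeriv_eq`,
`IsLeviCivita.extDerivOneForm_eq`).

*Dirac equation.* Clifford multiplication turns `∇X` into its trace and its skew part, so for
`φ = X · ψ` the Killing equation and `∑ e_b e_a e_b = 4 e_a` give `D φ = 4 λ φ`
(`NearlyKahler.eq_zero_of_divergence_free`).

*Vanishing.* The Bianchi identity turns `∑ e_b R_ab` into Clifford multiplication by the Ricci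
tensor, because the spin curvature is the two-form `¼ ∑ R_abcd e_c e_d`; here the rank eight of the
spinor bundle enters, through Schur's lemma (`IsCliffordFrame.eq_zero_of_commute`). On `ψ` the
Killing equation determines `R_ab ψ`, hence the Ricci tensor, and so the curvature term
`½ ∑ e_a e_b R_ab` of the Lichnerowicz formula is `30 λ²` on every spinor
(`IsCliffordFrame.sum_curvature_eq`, `NearlyKahler.lichnerowicz`). Hence `D φ = 4 λ φ` implies
`⟨∑ ∇²_{a,a} φ, φ⟩ = (30 - 16) λ² |φ|²`. At a maximum of `|φ|²` the Laplacian of `|φ|²`, which is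
`28 λ² |φ|² + 2 |∇φ|²`, is nonpositive, so `φ = 0` (`NearlyKahler.eq_zero_of_isLocalMax`,
`NearlyKahler.eq_zero_of_dirac`). Evaluating at a maximum replaces integration over `M`.
Finally `X · X · ψ = -|X|² ψ` and `ψ ≠ 0` give `X = 0`.
-/

noncomputable section

open Filter Topology VectorField

set_option linter.unusedSectionVars false

/-! ### Clifford modules of dimension eight over `ℝ⁶` -/

/-- The pair symmetry of an algebraic curvature tensor. -/
lemma curvature_pair_symm {R : Fin 6 → Fin 6 → Fin 6 → Fin 6 → ℝ}
    (hab : ∀ a b c d, R a b c d = -R b a c d) (hcd : ∀ a b c d, R a b c d = -R a b d c)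
    (hbi : ∀ a b c d, R a b c d + R b c a d + R c a b d = 0) (a b c d : Fin 6) :
    R a b c d = R c d a b := by
  linarith [hbi a b c d, hbi b c d a, hbi c d a b, hbi d a b c, hab a b c d, hcd a b c d,
    hab b c a d, hcd b c a d, hab c a b d, hcd c a b d, hab c d b a, hcd c d b a, hab d b c a,
    hcd d b c a, hcd d a c b, hab d a c b, hcd a c d b, hab a c d b, hcd a b d c, hab b d a c,
    hcd b d a c, hcd b c d a, hcd c d a b, hab d a b c, hcd d a b c, hcd c a d b, hcd d b a c]

section Clifford

variable {S : Type*} [NormedAddCommGroup S] [InnerProductSpace ℝ S]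

/-- The operators `e a` are the Clifford multiplications by the vectors of an orthonormal basis of
`ℝ⁶` on a space of spinors: skew-symmetric operators with `e a ∘ e a = -1` which anticommute. -/
structure IsCliffordFrame (e : Fin 6 → S →ₗ[ℝ] S) : Prop where
  sq : ∀ a s, e a (e a s) = -s
  anti : ∀ a b, a ≠ b → ∀ s, e a (e b s) = -e b (e a s)
  skew : ∀ a s t, inner ℝ (e a s) t = -inner ℝ s (e a t)

namespace IsCliffordFrame

variable {e : Fin 6 → S →ₗ[ℝ] S} (he : IsCliffordFrame e)

/-- Clifford multiplication by the volume element. -/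
def volume (e : Fin 6 → S →ₗ[ℝ] S) (s : S) : S := e 0 (e 1 (e 2 (e 3 (e 4 (e 5 s)))))

include he

lemma mul_mul (a b : Fin 6) (s : S) :
    e a (e b s) = -e b (e a s) - if a = b then (2 : ℝ) • s else 0 := by
  by_cases h : a = b
  · subst h
    simp only [he.sq, if_true]
    module
  · simp [h, he.anti a b h]

lemma ne_zero {v : S} (hv : v ≠ 0) (a : Fin 6) : e a v ≠ 0 := by
  intro h
  have := he.sq a v
  rw [h, map_zero] at this
  exact hv (neg_eq_zero.mp this.symm)

lemma volume_ne_zero {v : S} (hv : v ≠ 0) : volume e v ≠ 0 := by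
  unfold volume
  iterate 6 apply he.ne_zero
  exact hv

lemma inner_self_apply (v : S) (a : Fin 6) : inner ℝ v (e a v) = 0 := by
  have := he.skew a v v
  rw [real_inner_comm] at this
  linarith

lemma inner_apply_apply (v : S) {a b : Fin 6} (h : a ≠ b) : inner ℝ (e a v) (e b v) = 0 := by
  have h1 := he.skew a v (e b v)
  have h2 := he.skew b v (e a v)
  rw [he.anti a b h, inner_neg_right] at h1
  rw [real_inner_comm] at h2
  linarith

/-- The anticommutation relations as rewriting rules, which sort a product of generators. -/
lemma sort :
    (∀ s, e 1 (e 0 s) = -e 0 (e 1 s)) ∧ (∀ s, e 2 (e 0 s) = -e 0 (e 2 s)) ∧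
    (∀ s, e 3 (e 0 s) = -e 0 (e 3 s)) ∧ (∀ s, e 4 (e 0 s) = -e 0 (e 4 s)) ∧
    (∀ s, e 5 (e 0 s) = -e 0 (e 5 s)) ∧ (∀ s, e 2 (e 1 s) = -e 1 (e 2 s)) ∧
    (∀ s, e 3 (e 1 s) = -e 1 (e 3 s)) ∧ (∀ s, e 4 (e 1 s) = -e 1 (e 4 s)) ∧
    (∀ s, e 5 (e 1 s) = -e 1 (e 5 s)) ∧ (∀ s, e 3 (e 2 s) = -e 2 (e 3 s)) ∧
    (∀ s, e 4 (e 2 s) = -e 2 (e 4 s)) ∧ (∀ s, e 5 (e 2 s) = -e 2 (e 5 s)) ∧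
    (∀ s, e 4 (e 3 s) = -e 3 (e 4 s)) ∧ (∀ s, e 5 (e 3 s) = -e 3 (e 5 s)) ∧
    (∀ s, e 5 (e 4 s) = -e 4 (e 5 s)) := by
  refine ⟨?_, ?_, ?_, ?_, ?_, ?_, ?_, ?_, ?_, ?_, ?_, ?_, ?_, ?_, ?_⟩ <;>
    exact he.anti _ _ (by decide)

lemma inner_volume_self (v : S) : inner ℝ v (volume e v) = 0 := by
  have h : inner ℝ (volume e v) v = -inner ℝ v (volume e v) := by
    obtain ⟨h1, h2, h3, h4, h5, h6, h7, h8, h9, h10, h11, h12, h13, h14, h15⟩ := he.sort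
    simp only [volume, he.skew, h1, h2, h3, h4, h5, h6, h7, h8, h9, h10, h11, h12, h13, h14, h15,
      map_neg, inner_neg_right, neg_neg]
  rw [real_inner_comm] at h
  linarith

lemma apply_volume (a : Fin 6) (v : S) : e a (volume e v) = -volume e (e a v) := by
  obtain ⟨h1, h2, h3, h4, h5, h6, h7, h8, h9, h10, h11, h12, h13, h14, h15⟩ := he.sort
  fin_cases a <;>
  simp only [volume, he.sq, h1, h2, h3, h4, h5, h6, h7, h8, h9, h10, h11, h12, h13, h14, h15,
      map_neg, neg_neg, Fin.zero_eta, Fin.mk_one, Fin.reduceFinMk]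

lemma inner_apply_volume (v : S) (a : Fin 6) : inner ℝ (e a v) (volume e v) = 0 := by
  have h : inner ℝ (e a v) (volume e v) = -inner ℝ (e a v) (volume e v) := by
    conv_lhs => rw [he.skew, he.apply_volume, inner_neg_right, neg_neg]
    have h' : ∀ s t : S, inner ℝ s (volume e t) = -inner ℝ (volume e s) t := by
      intro s t
      obtain ⟨h1, h2, h3, h4, h5, h6, h7, h8, h9, h10, h11, h12, h13, h14, h15⟩ := he.sort
      simp only [volume, he.skew, h1, h2, h3, h4, h5, h6, h7, h8, h9, h10, h11, h12, h13, h14,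
        h15, map_neg, inner_neg_right, neg_neg]
    rw [h', real_inner_comm]
  linarith

/-- For `v ≠ 0`, the vectors `v`, `e a v` and `vol v` form an orthogonal basis of a space of spinors
of dimension eight. -/
lemma eq_zero_of_inner (hS : Module.finrank ℝ S = 8) {v t : S} (hv : v ≠ 0)
    (h0 : inner ℝ v t = 0) (h1 : ∀ a, inner ℝ (e a v) t = 0)
    (h2 : inner ℝ (volume e v) t = 0) : t = 0 := by
  let w : Fin 6 ⊕ Bool → S := Sum.elim (fun a => e a v) (fun i => if i then v else volume e v)
  have hli : LinearIndependent ℝ w := by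
    apply linearIndependent_of_ne_zero_of_inner_eq_zero
    · rintro (a | (_ | _))
      · exact he.ne_zero hv a
      · exact he.volume_ne_zero hv
      · exact hv
    · rintro (a | (_ | _)) (b | (_ | _)) hab
      · exact he.inner_apply_apply v (fun h => hab (by rw [h]))
      · exact he.inner_apply_volume v a
      · exact (real_inner_comm _ _).trans (he.inner_self_apply v a)
      · exact (real_inner_comm _ _).trans (he.inner_apply_volume v b)
      · exact absurd rfl hab
      · exact (real_inner_comm _ _).trans (he.inner_volume_self v)
      · exact he.inner_self_apply v b
      · exact he.inner_volume_self v
      · exact absurd rfl hab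
  let B := basisOfLinearIndependentOfCardEqFinrank hli (by simp [hS])
  have hB : ⇑B = w := coe_basisOfLinearIndependentOfCardEqFinrank hli _
  refine InnerProductSpace.ext_inner_left_basis (𝕜 := ℝ) B fun i => ?_
  rw [hB, inner_zero_right]
  rcases i with (a | (_ | _))
  · exact h1 a
  · exact h2
  · exact h0

/-- Every spinor of an eight-dimensional Clifford module is a combination of `v`, `e a v`,
`vol v`. -/
lemma exists_eq_add (hS : Module.finrank ℝ S = 8) {v : S} (hv : v ≠ 0) (t : S) :
    ∃ (c d : ℝ) (k : Fin 6 → ℝ), t = c • v + ∑ a, k a • e a v + d • volume e v := by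
  have hn : ∀ u : S, u ≠ 0 → (inner ℝ u u : ℝ) ≠ 0 := fun u hu => inner_self_ne_zero.mpr hu
  refine ⟨inner ℝ v t / inner ℝ v v, inner ℝ (volume e v) t / inner ℝ (volume e v) (volume e v),
    fun a => inner ℝ (e a v) t / inner ℝ (e a v) (e a v), ?_⟩
  rw [← sub_eq_zero]
  have hsym := fun x y : S => real_inner_comm x y
  apply he.eq_zero_of_inner hS hv
  · rw [inner_sub_right, inner_add_right, inner_add_right, inner_sum]
    simp only [inner_smul_right, he.inner_self_apply, he.inner_volume_self, mul_zero,
      Finset.sum_const_zero, add_zero]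
    rw [div_mul_cancel₀ _ (hn v hv), sub_self]
  · intro a
    rw [inner_sub_right, inner_add_right, inner_add_right, inner_sum]
    rw [Finset.sum_eq_single a]
    · simp only [inner_smul_right, he.inner_apply_volume, mul_zero, add_zero]
      rw [real_inner_comm v (e a v), he.inner_self_apply, mul_zero, zero_add,
        div_mul_cancel₀ _ (hn _ (he.ne_zero hv a)), sub_self]
    · intro b _ hb
      rw [inner_smul_right, he.inner_apply_apply v (Ne.symm hb), mul_zero]
    · simp
  · rw [inner_sub_right, inner_add_right, inner_add_right, inner_sum]
    have h6 : ∀ a, inner ℝ (volume e v) (e a v) = 0 := fun a =>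
      (hsym _ _).trans (he.inner_apply_volume v a)
    simp only [inner_smul_right, h6, mul_zero, Finset.sum_const_zero, add_zero]
    rw [real_inner_comm v (volume e v), he.inner_volume_self, mul_zero, zero_add,
      div_mul_cancel₀ _ (hn _ (he.volume_ne_zero hv)), sub_self]

omit he in
/-- An involution has an eigenvector among the vectors `s ± Q s`; it stays an eigenvector of the
involutions commuting with `Q` of which `s` is one. -/
lemma exists_eigenvector_step (Q : S →ₗ[ℝ] S) (hQ : ∀ s, Q (Q s) = s) {s : S} (hs : s ≠ 0) :
    ∃ (t : S) (η ε : ℝ), t ≠ 0 ∧ η * η = 1 ∧ Q t = η • t ∧ t = s + ε • Q s := by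
  by_cases h : s + Q s = 0
  · refine ⟨s - Q s, -1, -1, ?_, by norm_num, ?_, by module⟩
    · intro h'
      apply hs
      have : (2 : ℝ) • s = 0 := by
        calc (2 : ℝ) • s = (s + Q s) + (s - Q s) := by module
          _ = 0 := by rw [h, h', add_zero]
      simpa using this
    · rw [map_sub, hQ]; module
  · exact ⟨s + Q s, 1, 1, h, by norm_num, by rw [map_add, hQ]; module, by module⟩

omit he in
/-- If a symmetric operator `Q` has the eigenvalue `η = ±1` on `v` and `-η` on `u`, then a vector on
which it has the eigenvalue `η` is orthogonal to `u`. -/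
lemma inner_eq_zero_of_eigen {Q : S → S} (hQ : ∀ s t, inner ℝ (Q s) t = (inner ℝ s (Q t) : ℝ))
    {η : ℝ} (hη : η * η = 1) {u t : S} (hu : Q u = -(η • u)) (ht : Q t = η • t) :
    (inner ℝ u t : ℝ) = 0 := by
  have := hQ u t
  rw [hu, ht, inner_neg_left, inner_smul_left, inner_smul_right] at this
  simp only [conj_trivial] at this
  have h0 : η ≠ 0 := by rintro rfl; simp at hη
  have h2 : η * inner ℝ u t = 0 := by linarith
  exact (mul_eq_zero.mp h2).resolve_left h0

/-- An eight-dimensional Clifford module over `ℝ⁶` is absolutely irreducible: a skew operator which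
commutes with Clifford multiplication vanishes.  The commuting symmetric involutions `e₀e₁e₂`,
`e₀e₃e₄`, `e₁e₃e₅` have a common eigenvector `v`, and their eigenvalues separate the eight
orthogonal vectors `v`, `e a v`, `vol v`; so `C` maps `v` to a multiple of itself, which is zero. -/
lemma eq_zero_of_commute (hS : Module.finrank ℝ S = 8) (C : S →ₗ[ℝ] S)
    (hskew : ∀ s t, inner ℝ (C s) t = -(inner ℝ s (C t) : ℝ))
    (hcomm : ∀ a s, C (e a s) = e a (C s)) (s : S) : C s = 0 := by
  obtain ⟨h1, h2, h3, h4, h5, h6, h7, h8, h9, h10, h11, h12, h13, h14, h15⟩ := he.sort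
  let Q₁ : S →ₗ[ℝ] S := e 0 ∘ₗ e 1 ∘ₗ e 2
  let Q₂ : S →ₗ[ℝ] S := e 0 ∘ₗ e 3 ∘ₗ e 4
  let Q₃ : S →ₗ[ℝ] S := e 1 ∘ₗ e 3 ∘ₗ e 5
  have q₁ : ∀ s, Q₁ s = e 0 (e 1 (e 2 s)) := fun _ => rfl
  have q₂ : ∀ s, Q₂ s = e 0 (e 3 (e 4 s)) := fun _ => rfl
  have q₃ : ∀ s, Q₃ s = e 1 (e 3 (e 5 s)) := fun _ => rfl
  have i₁ : ∀ s, Q₁ (Q₁ s) = s := fun s => by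
    simp only [q₁, he.sq, h1, h2, h6, map_neg, neg_neg]
  have i₂ : ∀ s, Q₂ (Q₂ s) = s := fun s => by
    simp only [q₂, he.sq, h3, h4, h13, map_neg, neg_neg]
  have i₃ : ∀ s, Q₃ (Q₃ s) = s := fun s => by
    simp only [q₃, he.sq, h7, h9, h14, map_neg, neg_neg]
  have s₁ : ∀ s t, inner ℝ (Q₁ s) t = (inner ℝ s (Q₁ t) : ℝ) := fun s t => by
    simp only [q₁, he.skew, h1, h2, h6, map_neg, neg_neg, inner_neg_right]
  have s₂ : ∀ s t, inner ℝ (Q₂ s) t = (inner ℝ s (Q₂ t) : ℝ) := fun s t => by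
    simp only [q₂, he.skew, h3, h4, h13, map_neg, neg_neg, inner_neg_right]
  have s₃ : ∀ s t, inner ℝ (Q₃ s) t = (inner ℝ s (Q₃ t) : ℝ) := fun s t => by
    simp only [q₃, he.skew, h7, h9, h14, map_neg, neg_neg, inner_neg_right]
  have c₁₂ : ∀ s, Q₁ (Q₂ s) = Q₂ (Q₁ s) := fun s => by
    simp only [q₁, q₂, he.sq, h1, h2, h3, h4, h7, h8, h10, h11, map_neg, neg_neg]
  have c₁₃ : ∀ s, Q₁ (Q₃ s) = Q₃ (Q₁ s) := fun s => by
    simp only [q₁, q₃, he.sq, h1, h3, h5, h6, h7, h9, h10, h12, map_neg, neg_neg]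
  have c₂₃ : ∀ s, Q₂ (Q₃ s) = Q₃ (Q₂ s) := fun s => by
    simp only [q₂, q₃, he.sq, h1, h3, h5, h7, h8, h13, h14, h15, map_neg, neg_neg]
  by_contra hne
  have hs : s ≠ 0 := by rintro rfl; exact hne (map_zero C)
  obtain ⟨s₁', η₁, -, hs1, hη₁, hE1, -⟩ := exists_eigenvector_step Q₁ i₁ hs
  obtain ⟨s₂', η₂, ε₂, hs2, hη₂, hE2, hd2⟩ := exists_eigenvector_step Q₂ i₂ hs1
  obtain ⟨v, η₃, ε₃, hv, hη₃, hv₃, hd3⟩ := exists_eigenvector_step Q₃ i₃ hs2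
  have hE12 : Q₁ s₂' = η₁ • s₂' := by
    rw [hd2, map_add, map_smul, c₁₂, hE1, map_smul]; module
  have hv₁ : Q₁ v = η₁ • v := by
    rw [hd3, map_add, map_smul, c₁₃, hE12, map_smul]; module
  have hv₂ : Q₂ v = η₂ • v := by
    rw [hd3, map_add, map_smul, c₂₃, hE2, map_smul]; module
  have t₁ : Q₁ (C v) = η₁ • C v := by
    rw [← map_smul, ← hv₁]; simp only [q₁, hcomm]
  have t₂ : Q₂ (C v) = η₂ • C v := by
    rw [← map_smul, ← hv₂]; simp only [q₂, hcomm]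
  have t₃ : Q₃ (C v) = η₃ • C v := by
    rw [← map_smul, ← hv₃]; simp only [q₃, hcomm]
  have n₁ : ∀ a : Fin 6, a = 3 ∨ a = 4 ∨ a = 5 → Q₁ (e a v) = -(η₁ • e a v) := by
    intro a ha
    rw [← map_smul, ← hv₁]
    rcases ha with rfl | rfl | rfl <;>
    simp only [q₁, h3, h4, h5, h7, h8, h9, h10, h11, h12, map_neg, neg_neg]
  have n₂ : ∀ a : Fin 6, a = 1 ∨ a = 2 → Q₂ (e a v) = -(η₂ • e a v) := by
    intro a ha
    rw [← map_smul, ← hv₂]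
    rcases ha with rfl | rfl <;>
    simp only [q₂, h1, h2, h7, h8, h10, h11, map_neg, neg_neg]
  have n₃ : Q₃ (e 0 v) = -(η₃ • e 0 v) := by
    rw [← map_smul, ← hv₃]
    simp only [q₃, h1, h3, h5, map_neg, neg_neg]
  have nvol : Q₁ (volume e v) = -(η₁ • volume e v) := by
    have : η₁ • volume e v = volume e (η₁ • v) := by simp only [volume, map_smul]
    rw [this, ← hv₁]
    rw [q₁, q₁, he.apply_volume 2, map_neg, he.apply_volume 1, neg_neg, he.apply_volume 0]
  have hCv : C v = 0 := by
    apply he.eq_zero_of_inner hS hv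
    · have := hskew v v
      rw [real_inner_comm] at this
      linarith
    · intro a
      fin_cases a
      · exact inner_eq_zero_of_eigen s₃ hη₃ n₃ t₃
      · exact inner_eq_zero_of_eigen s₂ hη₂ (n₂ 1 (by decide)) t₂
      · exact inner_eq_zero_of_eigen s₂ hη₂ (n₂ 2 (by decide)) t₂
      · exact inner_eq_zero_of_eigen s₁ hη₁ (n₁ 3 (by decide)) t₁
      · exact inner_eq_zero_of_eigen s₁ hη₁ (n₁ 4 (by decide)) t₁
      · exact inner_eq_zero_of_eigen s₁ hη₁ (n₁ 5 (by decide)) t₁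
    · exact inner_eq_zero_of_eigen s₁ hη₁ nvol t₁
  obtain ⟨c, d, k, hs'⟩ := he.exists_eq_add hS hv s
  apply hne
  rw [hs']
  simp only [map_add, map_sum, map_smul, volume, hcomm, hCv, map_zero, smul_zero,
    Finset.sum_const_zero, add_zero]

/-! ### The curvature endomorphism of a Clifford module -/

/-- The Clifford contraction of a curvature tensor is its Ricci tensor:
`∑ R_abcd e_b e_c e_d = -2 ∑ R_abbd e_d`. Sorting the cyclic permutations of the product
`e_b e_c e_d` produces Ricci terms, and the sum over the cyclic permutations vanishes by the first
Bianchi identity. -/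
lemma sum_curvature_mul (R : Fin 6 → Fin 6 → Fin 6 → ℝ)
    (hcd : ∀ b c d, R b c d = -R b d c)
    (hbi : ∀ b c d, R b c d + R c d b + R d b c = 0) (s : S) :
    ∑ b, ∑ c, ∑ d, R b c d • e b (e c (e d s))
      = -(2 : ℝ) • ∑ b, ∑ d, R b b d • e d s := by
  set Q := ∑ b, ∑ c, ∑ d, R b c d • e b (e c (e d s)) with hQ
  set P := ∑ b, ∑ d, R b b d • e d s with hP
  have hδ₁ : ∑ b, ∑ c, ∑ d, R b c d • (if c = b then (2 : ℝ) • e d s else 0) = (2 : ℝ) • P := by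
    rw [hP, Finset.smul_sum]
    refine Finset.sum_congr rfl fun b _ => ?_
    rw [Finset.sum_comm, Finset.smul_sum]
    refine Finset.sum_congr rfl fun d _ => ?_
    simp only [smul_ite, smul_zero, Finset.sum_ite_eq', Finset.mem_univ, if_true]
    rw [smul_comm]
  have hδ₂ : ∑ b, ∑ c, ∑ d, R b c d • (if d = b then (2 : ℝ) • e c s else 0)
      = -(2 : ℝ) • P := by
    rw [hP, Finset.smul_sum]
    refine Finset.sum_congr rfl fun b _ => ?_
    rw [Finset.smul_sum]
    refine Finset.sum_congr rfl fun c _ => ?_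
    simp only [smul_ite, smul_zero, Finset.sum_ite_eq', Finset.mem_univ, if_true]
    rw [hcd b c b]
    module
  have hδ₃ : ∑ b, ∑ c, ∑ d, R b c d • (if d = c then (2 : ℝ) • e b s else 0) = 0 := by
    refine Finset.sum_eq_zero fun b _ => Finset.sum_eq_zero fun c _ => ?_
    simp only [smul_ite, smul_zero, Finset.sum_ite_eq', Finset.mem_univ, if_true]
    have := hcd b c c
    have h0 : R b c c = 0 := by linarith
    rw [h0, zero_smul]
  have h1 : ∑ b, ∑ c, ∑ d, R b c d • e c (e d (e b s)) = Q + (4 : ℝ) • P := by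
    have : ∀ b c d, R b c d • e c (e d (e b s)) = R b c d • e b (e c (e d s))
        + R b c d • (if c = b then (2 : ℝ) • e d s else 0)
        - R b c d • (if d = b then (2 : ℝ) • e c s else 0) := by
      intro b c d
      rw [he.mul_mul d b, map_sub, map_neg, he.mul_mul c b, apply_ite (e c), map_zero, map_smul]
      module
    simp only [this, Finset.sum_add_distrib, Finset.sum_sub_distrib, hδ₁, hδ₂, ← hQ]
    module
  have h2 : ∑ b, ∑ c, ∑ d, R b c d • e d (e b (e c s)) = Q + (2 : ℝ) • P := by
    have : ∀ b c d, R b c d • e d (e b (e c s)) = R b c d • e b (e c (e d s))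
        + R b c d • (if d = c then (2 : ℝ) • e b s else 0)
        - R b c d • (if d = b then (2 : ℝ) • e c s else 0) := by
      intro b c d
      rw [he.mul_mul d b, he.mul_mul d c, map_sub, map_neg, apply_ite (e b), map_zero, map_smul]
      module
    simp only [this, Finset.sum_add_distrib, Finset.sum_sub_distrib, hδ₃, hδ₂, ← hQ]
    module
  have h3 : Q + (Q + (4 : ℝ) • P) + (Q + (2 : ℝ) • P) = 0 := by
    rw [← h1, ← h2]
    have r1 : ∑ b, ∑ c, ∑ d, R b c d • e c (e d (e b s))
        = ∑ b, ∑ c, ∑ d, R d b c • e b (e c (e d s)) := by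
      rw [Finset.sum_comm]
      exact Finset.sum_congr rfl fun b _ => Finset.sum_comm
    have r2 : ∑ b, ∑ c, ∑ d, R b c d • e d (e b (e c s))
        = ∑ b, ∑ c, ∑ d, R c d b • e b (e c (e d s)) := by
      rw [Finset.sum_congr rfl fun b _ => Finset.sum_comm]
      rw [Finset.sum_comm]
    rw [r1, r2, hQ]
    simp only [← Finset.sum_add_distrib, ← add_smul]
    refine Finset.sum_eq_zero fun b _ => Finset.sum_eq_zero fun c _ =>
      Finset.sum_eq_zero fun d _ => ?_
    rw [show R b c d + R d b c + R c d b = 0 by linarith [hbi b c d], zero_smul]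
  have h4 : (3 : ℝ) • (Q + (2 : ℝ) • P) = 0 := by rw [← h3]; module
  have h5 : Q + (2 : ℝ) • P = 0 := (smul_eq_zero.mp h4).resolve_left (by norm_num)
  rw [eq_neg_of_add_eq_zero_left h5, neg_smul]

/-- The commutator of a vector with a two-form in the Clifford algebra is the action of the
two-form, seen as a skew matrix, on the vector. -/
lemma commutator_twoForm (r : Fin 6 → Fin 6 → ℝ) (hr : ∀ c d, r c d = -r d c) (k : Fin 6) (s : S) :
    ∑ c, ∑ d, r c d • e c (e d (e k s)) =
      e k (∑ c, ∑ d, r c d • e c (e d s)) + (4 : ℝ) • ∑ d, r k d • e d s := by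
  have : ∀ c d, r c d • e c (e d (e k s)) = r c d • e k (e c (e d s))
      + r c d • (if c = k then (2 : ℝ) • e d s else 0)
      - r c d • (if d = k then (2 : ℝ) • e c s else 0) := by
    intro c d
    rw [he.mul_mul d k, map_sub, map_neg, he.mul_mul c k, apply_ite (e c), map_zero, map_smul]
    module
  simp only [this, Finset.sum_add_distrib, Finset.sum_sub_distrib, map_sum, map_smul]
  have h1 : ∑ c, ∑ d, r c d • (if c = k then (2 : ℝ) • e d s else 0)
      = (2 : ℝ) • ∑ d, r k d • e d s := by
    rw [Finset.sum_comm, Finset.smul_sum]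
    refine Finset.sum_congr rfl fun d _ => ?_
    simp only [smul_ite, smul_zero, Finset.sum_ite_eq', Finset.mem_univ, if_true]
    rw [smul_comm]
  have h2 : ∑ c, ∑ d, r c d • (if d = k then (2 : ℝ) • e c s else 0)
      = -(2 : ℝ) • ∑ d, r k d • e d s := by
    rw [Finset.smul_sum]
    refine Finset.sum_congr rfl fun c _ => ?_
    simp only [smul_ite, smul_zero, Finset.sum_ite_eq', Finset.mem_univ, if_true]
    rw [hr c k]
    module
  rw [h1, h2]
  module

/-- A skew operator on spinors which acts on vectors by the skew matrix `r` is Clifford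
multiplication by the two-form `¼ ∑ r_cd e_c e_d`. -/
lemma eq_twoForm (hS : Module.finrank ℝ S = 8) (A : S →ₗ[ℝ] S)
    (hskew : ∀ s t, inner ℝ (A s) t = -(inner ℝ s (A t) : ℝ))
    (r : Fin 6 → Fin 6 → ℝ) (hr : ∀ c d, r c d = -r d c)
    (hA : ∀ k s, A (e k s) = e k (A s) + ∑ d, r k d • e d s) (s : S) :
    A s = (1 / 4 : ℝ) • ∑ c, ∑ d, r c d • e c (e d s) := by
  let C : S →ₗ[ℝ] S := A - (1 / 4 : ℝ) • ∑ c, ∑ d, r c d • (e c ∘ₗ e d)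
  have hC : ∀ s, C s = A s - (1 / 4 : ℝ) • ∑ c, ∑ d, r c d • e c (e d s) := by
    intro s
    simp [C, LinearMap.sum_apply]
  have h0 : C s = 0 := by
    apply he.eq_zero_of_commute hS
    · intro s t
      have : ∑ c, ∑ d, r c d • (inner ℝ (e c (e d s)) t : ℝ)
          = -∑ c, ∑ d, r c d • (inner ℝ s (e c (e d t)) : ℝ) := by
        rw [Finset.sum_comm, ← Finset.sum_neg_distrib]
        refine Finset.sum_congr rfl fun c _ => ?_
        rw [← Finset.sum_neg_distrib]
        refine Finset.sum_congr rfl fun d _ => ?_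
        rw [he.skew, he.skew, neg_neg, hr d c, neg_smul]
      rw [hC, hC, inner_sub_left, inner_sub_right, hskew, inner_smul_left, inner_smul_right,
        sum_inner, inner_sum]
      simp only [sum_inner, inner_sum, inner_smul_left, inner_smul_right, conj_trivial]
      simp only [smul_eq_mul] at this
      rw [this]
      ring
    · intro k s
      rw [hC, hC, hA, he.commutator_twoForm r hr, map_sub, map_smul]
      module
  rw [hC] at h0
  exact sub_eq_zero.mp h0

lemma smul_sum_eq_zero {v : S} (hv : v ≠ 0) {k : Fin 6 → ℝ} (h : ∑ d, k d • e d v = 0)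
    (a : Fin 6) : k a = 0 := by
  have h1 : (inner ℝ (e a v) (∑ d, k d • e d v) : ℝ) = 0 := by rw [h, inner_zero_right]
  rw [inner_sum, Finset.sum_eq_single a] at h1
  · rw [inner_smul_right] at h1
    exact (mul_eq_zero.mp h1).resolve_right (inner_self_ne_zero.mpr (he.ne_zero hv a))
  · intro b _ hb
    rw [inner_smul_right, he.inner_apply_apply v (Ne.symm hb), mul_zero]
  · simp

lemma sum_mul_mul_mul (a : Fin 6) (s : S) : ∑ b, e b (e a (e b s)) = (4 : ℝ) • e a s := by
  have : ∀ b, e b (e a (e b s)) = e a s - if b = a then (2 : ℝ) • e a s else 0 := by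
    intro b
    rw [he.mul_mul b a, he.sq, map_neg, neg_neg]
    by_cases h : b = a
    · subst h; rfl
    · simp [h]
  simp only [this, Finset.sum_sub_distrib, Finset.sum_ite_eq', Finset.mem_univ, if_true,
    Finset.sum_const, Finset.card_univ, Fintype.card_fin]
  module

/-- If the curvature operators `A a b` of a spin connection are those of a Killing spinor with
constant `l` on some `ψ ≠ 0`, then the Ricci tensor is `20 l²` times the metric, and the curvature
term `½ ∑ e_a e_b A_ab` of the Lichnerowicz formula is the multiple `30 l²` of the identity. -/
theorem sum_curvature_eq (hS : Module.finrank ℝ S = 8) (A : Fin 6 → Fin 6 → S →ₗ[ℝ] S)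
    (hskew : ∀ a b s t, inner ℝ (A a b s) t = -(inner ℝ s (A a b t) : ℝ))
    (R : Fin 6 → Fin 6 → Fin 6 → Fin 6 → ℝ)
    (hab : ∀ a b c d, R a b c d = -R b a c d) (hcd : ∀ a b c d, R a b c d = -R a b d c)
    (hbi : ∀ a b c d, R a b c d + R b c a d + R c a b d = 0)
    (hA : ∀ a b k s, A a b (e k s) = e k (A a b s) + ∑ d, R a b k d • e d s)
    {ψ : S} (hψ : ψ ≠ 0) (l : ℝ)
    (hl : ∀ a b, A a b ψ = l ^ 2 • (e b (e a ψ) - e a (e b ψ))) (s : S) :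
    ∑ a, ∑ b, e a (e b (A a b s)) = (60 * l ^ 2) • s := by
  have hric : ∀ a s, ∑ b, e b (A a b s) = -(1 / 2 : ℝ) • ∑ d, (∑ b, R a b b d) • e d s := by
    intro a s
    have h1 : ∀ b, e b (A a b s) =
        (1 / 4 : ℝ) • ∑ c, ∑ d, R a b c d • e b (e c (e d s)) := by
      intro b
      rw [he.eq_twoForm hS (A a b) (hskew a b) (R a b) (hcd a b) (hA a b)]
      simp only [map_smul, map_sum]
    simp only [h1]
    rw [← Finset.smul_sum, he.sum_curvature_mul (R a) (hcd a)]
    · rw [Finset.sum_comm]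
      simp only [Finset.sum_smul]
      module
    · intro b c d
      have hp := curvature_pair_symm hab hcd hbi
      rw [hp a b c d, hp a c d b, hp a d b c]
      have h2 := hbi c d b a
      linarith [hcd c d a b, hcd d b a c, hcd b c a d]
  have hein : ∀ a d, ∑ b, R a b b d = if d = a then 20 * l ^ 2 else 0 := by
    intro a d
    have h1 := hric a ψ
    simp only [hl, map_smul, map_sub, he.sq] at h1
    rw [← Finset.smul_sum, Finset.sum_sub_distrib, he.sum_mul_mul_mul] at h1
    have h2 : ∑ d, (∑ b, R a b b d - if d = a then 20 * l ^ 2 else 0) • e d ψ = 0 := by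
      simp only [sub_smul, Finset.sum_sub_distrib, ite_smul, zero_smul, Finset.sum_ite_eq',
        Finset.mem_univ, if_true]
      have h3 : ∑ d, (∑ b, R a b b d) • e d ψ
          = -(2 : ℝ) • (-(1 / 2 : ℝ) • ∑ d, (∑ b, R a b b d) • e d ψ) := by module
      rw [h3, ← h1]
      simp only [Finset.sum_const, Finset.card_univ, Fintype.card_fin]
      module
    exact sub_eq_zero.mp (he.smul_sum_eq_zero hψ h2 d)
  have h1 : ∀ a, ∑ b, e a (e b (A a b s)) = (10 * l ^ 2) • s := by
    intro a
    rw [← map_sum, hric]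
    simp only [hein, ite_smul, zero_smul, Finset.sum_ite_eq', Finset.mem_univ, if_true, map_smul,
      he.sq]
    module
  simp only [h1, Finset.sum_const, Finset.card_univ, Fintype.card_fin]
  module

/-- The Clifford contraction of a bilinear expression: minus its trace plus the contraction of its
antisymmetric part. -/
lemma sum_mul_mul_eq (h : Fin 6 → Fin 6 → S) :
    ∑ a, ∑ b, e a (e b (h a b)) =
      -∑ a, h a a + (1 / 2 : ℝ) • ∑ a, ∑ b, e a (e b (h a b - h b a)) := by
  have h1 : ∑ a, ∑ b, e a (e b (h b a)) =
      -∑ a, ∑ b, e a (e b (h a b)) - (2 : ℝ) • ∑ a, h a a := by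
    rw [Finset.sum_comm]
    have : ∀ b a, e a (e b (h b a)) = -e b (e a (h b a)) -
        if a = b then (2 : ℝ) • h b a else 0 := fun b a => he.mul_mul a b _
    simp only [this, Finset.sum_sub_distrib, Finset.sum_neg_distrib, Finset.sum_ite_eq',
      Finset.mem_univ, if_true, Finset.smul_sum]
  simp only [map_sub, Finset.sum_sub_distrib, h1]
  module

end IsCliffordFrame

end Clifford

/-- Smoothness of a section of a vector bundle with model fibre `F` over a six-manifold. -/
abbrev SmoothSection {M : Type*} [TopologicalSpace M] [ChartedSpace E6 M]
    (F : Type*) [NormedAddCommGroup F] [NormedSpace ℝ F] {V : M → Type*}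
    [TopologicalSpace (TotalSpace F V)] [∀ x, TopologicalSpace (V x)] [FiberBundle F V]
    (s : ∀ x, V x) : Prop :=
  ContMDiff (𝓡 6) ((𝓡 6).prod 𝓘(ℝ, F)) ∞ (fun x => TotalSpace.mk' F x (s x))

/-- Smoothness of a vector field on a six-manifold. -/
abbrev SmoothField {M : Type*} [TopologicalSpace M] [ChartedSpace E6 M]
    [IsManifold (𝓡 6) ∞ M] (X : ∀ x : M, TangentSpace (𝓡 6) x) : Prop :=
  SmoothSection E6 (V := fun x : M => TangentSpace (𝓡 6) x) X

/-! ### Derivatives of functions along vector fields -/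

section Functions

variable {M : Type*} [TopologicalSpace M] [ChartedSpace E6 M] [IsManifold (𝓡 6) ∞ M]

lemma contMDiff_mvfderiv_apply {f : M → ℝ} (hf : ContMDiff (𝓡 6) 𝓘(ℝ, ℝ) ∞ f)
    {V : ∀ x : M, TangentSpace (𝓡 6) x} (hV : SmoothField V) :
    ContMDiff (𝓡 6) 𝓘(ℝ, ℝ) ∞ (fun y => mvfderiv (𝓡 6) f y (V y)) := by
  have h1 : ContMDiff (𝓡 6).tangent 𝓘(ℝ, ℝ).tangent ∞ (tangentMap (𝓡 6) 𝓘(ℝ, ℝ) f) :=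
    hf.contMDiff_tangentMap (by simp)
  have h2 := h1.comp hV
  have h3 : ContMDiff 𝓘(ℝ, ℝ).tangent 𝓘(ℝ, ℝ) ∞ (fun w : TangentBundle 𝓘(ℝ, ℝ) ℝ => w.2) := by
    exact contMDiff_snd_tangentBundle_modelSpace ℝ 𝓘(ℝ, ℝ)
  exact h3.comp h2

omit [IsManifold (𝓡 6) ∞ M] in
/-- The derivative of a function along an integral curve. -/
lemma hasDerivAt_comp_of_hasMFDerivAt {f : M → ℝ} (hf : MDifferentiable (𝓡 6) 𝓘(ℝ, ℝ) f)
    {γ : ℝ → M} {t : ℝ} {v : TangentSpace (𝓡 6) (γ t)}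
    (hγ : HasMFDerivAt 𝓘(ℝ, ℝ) (𝓡 6) γ t
      ((1 : ℝ →L[ℝ] ℝ).smulRight v : ℝ →L[ℝ] TangentSpace (𝓡 6) (γ t))) :
    HasDerivAt (f ∘ γ) (mvfderiv (𝓡 6) f (γ t) v) t := by
  have h := ((hf (γ t)).hasMFDerivAt.comp t hγ).hasFDerivAt
  have h' := (show HasFDerivAt (f ∘ γ) (_ : ℝ →L[ℝ] ℝ) t from h).hasDerivAt
  convert h' using 1
  change _ = (mfderiv (𝓡 6) 𝓘(ℝ, ℝ) f (γ t)) ((1 : ℝ) • v)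
  rw [one_smul]
  rfl

/-- First and second derivative test along the integral curve of a vector field. -/
lemma IsLocalMax.mvfderiv_mvfderiv_nonpos {f : M → ℝ} {x : M} (hmax : IsLocalMax f x)
    (hf : ContMDiff (𝓡 6) 𝓘(ℝ, ℝ) ∞ f)
    {V : ∀ x : M, TangentSpace (𝓡 6) x} (hV : SmoothField V) :
    mvfderiv (𝓡 6) f x (V x) = 0 ∧
      mvfderiv (𝓡 6) (fun y => mvfderiv (𝓡 6) f y (V y)) x (V x) ≤ 0 := by
  have hVf := contMDiff_mvfderiv_apply hf hV
  obtain ⟨γ, hγ0, hγ⟩ := exists_isMIntegralCurveAt_of_contMDiffAt_boundaryless (I := 𝓡 6) 0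
    ((hV x).of_le (by norm_cast))
  have hγ' : ∀ᶠ t in 𝓝 (0 : ℝ), HasDerivAt (f ∘ γ) (mvfderiv (𝓡 6) f (γ t) (V (γ t))) t := by
    filter_upwards [hγ] with t ht
    exact hasDerivAt_comp_of_hasMFDerivAt (hf.mdifferentiable (by simp)) ht
  have hd0 := hγ'.self_of_nhds
  have hc : ContinuousAt γ 0 := hγ.self_of_nhds.continuousAt
  have hmaxγ : IsLocalMax (f ∘ γ) 0 := by
    have : Tendsto γ (𝓝 0) (𝓝 x) := by simpa [ContinuousAt, hγ0] using hc
    have h := this.eventually hmax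
    simpa [IsLocalMax, IsMaxFilter, hγ0] using h
  have h1 := hmaxγ.hasDerivAt_eq_zero hd0
  have hd2 : HasDerivAt (deriv (f ∘ γ))
      (mvfderiv (𝓡 6) (fun y => mvfderiv (𝓡 6) f y (V y)) (γ 0) (V (γ 0))) 0 := by
    refine (hasDerivAt_comp_of_hasMFDerivAt (hVf.mdifferentiable (by simp))
      hγ.self_of_nhds).congr_of_eventuallyEq ?_
    filter_upwards [hγ'] with t ht
    exact ht.deriv
  subst hγ0
  refine ⟨h1, ?_⟩
  by_contra! hpos
  have hmin := isLocalMin_of_deriv_deriv_pos (f := f ∘ γ) (x₀ := 0) (by rw [hd2.deriv]; exact hpos)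
    (by rw [hd0.deriv]; exact h1) hd0.continuousAt
  have hconst : f ∘ γ =ᶠ[𝓝 0] fun _ => (f ∘ γ) 0 := by
    filter_upwards [hmin, hmaxγ] with t h1 h2
    exact le_antisymm h2 h1
  have := hconst.deriv.deriv_eq
  rw [hd2.deriv] at this
  simp at this
  exact hpos.ne' this

/-- The commutator of two derivations of functions is the Lie bracket. The Jacobi identity for `W`,
`V` and `f • Z` expresses the difference of the two sides, multiplied with `Z`, as zero. -/
lemma mvfderiv_mlieBracket {f : M → ℝ} (hf : ContMDiff (𝓡 6) 𝓘(ℝ, ℝ) ∞ f)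
    {V W : ∀ x : M, TangentSpace (𝓡 6) x} (hV : SmoothField V) (hW : SmoothField W) (x : M)
    {Z : ∀ x : M, TangentSpace (𝓡 6) x} (hZ : SmoothField Z) (hZx : Z x ≠ 0) :
    mvfderiv (𝓡 6) (fun y => mvfderiv (𝓡 6) f y (W y)) x (V x)
      - mvfderiv (𝓡 6) (fun y => mvfderiv (𝓡 6) f y (V y)) x (W x)
      = mvfderiv (𝓡 6) f x (mlieBracket (𝓡 6) V W x) := by
  have : IsManifold (𝓡 6) (minSmoothness ℝ 3) M :=
    IsManifold.of_le (n := ∞) (by simp only [minSmoothness_of_isRCLikeNormedField]; norm_cast)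
  have : IsManifold (𝓡 6) (minSmoothness ℝ 2) M :=
    IsManifold.of_le (n := ∞) (by simp only [minSmoothness_of_isRCLikeNormedField]; norm_cast)
  have : IsManifold (𝓡 6) (((⊤ : ℕ∞) : WithTop ℕ∞) + 1) M := IsManifold.of_le (n := ∞) (by simp)
  have hfd : MDifferentiable (𝓡 6) 𝓘(ℝ, ℝ) f := hf.mdifferentiable (by simp)
  have mds : ∀ {U : ∀ x : M, TangentSpace (𝓡 6) x}, SmoothField U →
      ∀ y, MDifferentiableAt (𝓡 6) (𝓡 6).tangent
      (fun x => TotalSpace.mk' E6 (E := fun x : M => TangentSpace (𝓡 6) x) x (U x)) y :=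
    fun hU y => (hU y).mdifferentiableAt (by simp)
  have hbr : ∀ {U U' : ∀ x : M, TangentSpace (𝓡 6) x}, SmoothField U → SmoothField U' →
      SmoothField (mlieBracket (𝓡 6) U U') := by
    intro U U' hU hU' y
    exact ContMDiffAt.mlieBracket_vectorField (m := ⊤) (n := ⊤) (hU y) (hU' y) (by simp)
  have key : ∀ {U : ∀ x : M, TangentSpace (𝓡 6) x},
      mlieBracket (𝓡 6) U (f • Z) = (fun y => mvfderiv (𝓡 6) f y (U y)) • Z
        + f • mlieBracket (𝓡 6) U Z := by
    intro U
    ext1 y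
    exact mlieBracket_smul_right (hfd y) (mds hZ y)
  have hfZ : SmoothField (f • Z) := hf.smul_section hZ
  have le2 : minSmoothness ℝ 2 ≤ (∞ : WithTop ℕ∞) := by
    simp only [minSmoothness_of_isRCLikeNormedField]; norm_cast
  have J1 := leibniz_identity_mlieBracket_apply (I := 𝓡 6) ((hV x).of_le le2) ((hW x).of_le le2)
    ((hfZ x).of_le le2)
  have J2 := leibniz_identity_mlieBracket_apply (I := 𝓡 6) ((hV x).of_le le2) ((hW x).of_le le2)
    ((hZ x).of_le le2)
  have e : ∀ {U U' : ∀ x : M, TangentSpace (𝓡 6) x}, SmoothField U → SmoothField U' →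
      mlieBracket (𝓡 6) U (mlieBracket (𝓡 6) U' (f • Z)) x =
        mvfderiv (𝓡 6) (fun y => mvfderiv (𝓡 6) f y (U' y)) x (U x) • Z x
        + mvfderiv (𝓡 6) f x (U' x) • mlieBracket (𝓡 6) U Z x
        + (mvfderiv (𝓡 6) f x (U x) • mlieBracket (𝓡 6) U' Z x
          + f x • mlieBracket (𝓡 6) U (mlieBracket (𝓡 6) U' Z) x) := by
    intro U U' hU hU'
    have hg := contMDiff_mvfderiv_apply hf hU'
    rw [key, mlieBracket_add_right (mds (hg.smul_section hZ) x)
      (mds (hf.smul_section (hbr hU' hZ)) x),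
      mlieBracket_smul_right (hfd x) (mds (hbr hU' hZ) x),
      mlieBracket_smul_right (hg.mdifferentiable (by simp) x) (mds hZ x)]
  rw [e hV hW, e hW hV, key, J2] at J1
  simp only [Pi.add_apply, Pi.smul_apply'] at J1
  have : (mvfderiv (𝓡 6) (fun y => mvfderiv (𝓡 6) f y (W y)) x (V x)
      - mvfderiv (𝓡 6) (fun y => mvfderiv (𝓡 6) f y (V y)) x (W x)
      - mvfderiv (𝓡 6) f x (mlieBracket (𝓡 6) V W x)) • Z x = 0 := by
    rw [← sub_eq_zero] at J1
    rw [← J1]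
    module
  exact sub_eq_zero.mp ((smul_eq_zero.mp this).resolve_right hZx)

end Functions

/-! ### Smooth orthonormal frames -/

section Frames

variable {M : Type*} [TopologicalSpace M] [ChartedSpace E6 M] [IsManifold (𝓡 6) ∞ M]
  [RiemannianBundle (fun x : M => TangentSpace (𝓡 6) x)]
  [IsContMDiffRiemannianBundle (𝓡 6) ∞ E6 (fun x : M => TangentSpace (𝓡 6) x)]

/-- The Gram-Schmidt process applied to a smooth local frame gives smooth vector fields. -/
lemma contMDiffOn_gramSchmidt {U : Set M} {s : Fin 6 → ∀ x : M, TangentSpace (𝓡 6) x}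
    (hs : ∀ i, ContMDiffOn (𝓡 6) ((𝓡 6).prod 𝓘(ℝ, E6)) ∞
      (fun x => TotalSpace.mk' E6 (E := fun x : M => TangentSpace (𝓡 6) x) x (s i x)) U)
    (hli : ∀ x ∈ U, LinearIndependent ℝ (fun i => s i x)) (n : Fin 6) :
    ContMDiffOn (𝓡 6) ((𝓡 6).prod 𝓘(ℝ, E6)) ∞
      (fun x => TotalSpace.mk' E6 (E := fun x : M => TangentSpace (𝓡 6) x) x
        (InnerProductSpace.gramSchmidt ℝ (fun i => s i x) n)) U := by
  induction n using WellFoundedLT.induction with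
  | ind n ih =>
  have h : ∀ x, InnerProductSpace.gramSchmidt ℝ (fun i => s i x) n = s n x -
      ∑ i ∈ Finset.Iio n,
        ((inner ℝ (InnerProductSpace.gramSchmidt ℝ (fun i => s i x) i) (s n x) : ℝ)
        / (inner ℝ (InnerProductSpace.gramSchmidt ℝ (fun i => s i x) i)
          (InnerProductSpace.gramSchmidt ℝ (fun i => s i x) i) : ℝ))
        • InnerProductSpace.gramSchmidt ℝ (fun i => s i x) i := by
    intro x
    rw [InnerProductSpace.gramSchmidt_def]
    congr 1
    refine Finset.sum_congr rfl fun i _ => ?_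
    rw [Submodule.starProjection_singleton, real_inner_self_eq_norm_sq]
    rfl
  simp only [h]
  refine (hs n).sub_section (ContMDiffOn.sum_section fun i hi => ?_)
  have hi' := ih i (Finset.mem_Iio.mp hi)
  refine ContMDiffOn.smul_section (ContMDiffOn.div₀ (hi'.inner_bundle (hs n))
    (hi'.inner_bundle hi') fun x hx => ?_) hi'
  exact inner_self_ne_zero.mpr (InnerProductSpace.gramSchmidt_ne_zero i (hli x hx))

/-- Near every point there is an orthonormal frame of the tangent bundle which consists of globally
defined smooth vector fields. -/
theorem exists_orthonormal_frame [T2Space M] (x₀ : M) :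
    ∃ (E : Fin 6 → ∀ x : M, TangentSpace (𝓡 6) x) (U : Set M), (∀ a, SmoothField (E a)) ∧
      IsOpen U ∧ x₀ ∈ U ∧ ∀ x ∈ U, Orthonormal ℝ (fun a => E a x) := by
  let t := trivializationAt E6 (fun x : M => TangentSpace (𝓡 6) x) x₀
  let b : Module.Basis (Fin 6) ℝ E6 := (EuclideanSpace.basisFun (Fin 6) ℝ).toBasis
  let s := t.localFrame b
  have hs := t.isLocalFrameOn_localFrame_baseSet (𝓡 6) ∞ b
  have hx₀ : x₀ ∈ t.baseSet := FiberBundle.mem_baseSet_trivializationAt' x₀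
  have hG : ∀ n, ContMDiffOn (𝓡 6) ((𝓡 6).prod 𝓘(ℝ, E6)) ∞
      (fun x => TotalSpace.mk' E6 (E := fun x : M => TangentSpace (𝓡 6) x) x
        (InnerProductSpace.gramSchmidtNormed ℝ (fun i => s i x) n)) t.baseSet := by
    intro n
    have h1 := contMDiffOn_gramSchmidt hs.contMDiffOn (fun x hx => hs.linearIndependent hx) n
    have hpos : ∀ x ∈ t.baseSet, (0 : ℝ) <
        inner ℝ (InnerProductSpace.gramSchmidt ℝ (fun i => s i x) n)
        (InnerProductSpace.gramSchmidt ℝ (fun i => s i x) n) := fun x hx =>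
      real_inner_self_pos.mpr
        (InnerProductSpace.gramSchmidt_ne_zero n (hs.linearIndependent hx))
    have h2 : ContMDiffOn (𝓡 6) 𝓘(ℝ, ℝ) ∞ (fun x =>
        (Real.sqrt (inner ℝ (InnerProductSpace.gramSchmidt ℝ (fun i => s i x) n)
          (InnerProductSpace.gramSchmidt ℝ (fun i => s i x) n)))⁻¹) t.baseSet := by
      refine ContMDiffOn.inv₀ (fun x hx => ?_) fun x hx => (Real.sqrt_pos.mpr (hpos x hx)).ne'
      exact ((Real.contDiffAt_sqrt (hpos x hx).ne').contMDiffAt).comp_contMDiffWithinAt x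
        (h1.inner_bundle h1 x hx)
    refine (h2.smul_section h1).congr fun x _ => ?_
    simp only [InnerProductSpace.gramSchmidtNormed, Pi.smul_apply', norm_eq_sqrt_real_inner]
    rfl
  obtain ⟨χ, -, hχ⟩ := (SmoothBumpFunction.nhds_basis_tsupport (I := 𝓡 6) x₀).mem_iff.mp
    (t.open_baseSet.mem_nhds hx₀)
  obtain ⟨U, hU1, hUo, hUx⟩ := eventually_nhds_iff.mp χ.eventuallyEq_one
  refine ⟨fun a => (χ : M → ℝ) • fun x =>
    InnerProductSpace.gramSchmidtNormed ℝ (fun i => s i x) a, U ∩ t.baseSet, fun a => ?_,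
    hUo.inter t.open_baseSet, ⟨hUx, hx₀⟩, fun x hx => ?_⟩
  · exact ContMDiffOn.smul_section_of_tsupport χ.contMDiff.contMDiffOn t.open_baseSet hχ (hG a)
  · have h1 : χ x = 1 := hU1 x hx.1
    simp only [Pi.smul_apply', h1, one_smul]
    exact InnerProductSpace.gramSchmidtNormed_orthonormal (hs.linearIndependent hx.2)

end Frames

/-! ### Second covariant derivatives and curvature -/

section Hessian

variable {M : Type*} [TopologicalSpace M] [ChartedSpace E6 M] [IsManifold (𝓡 6) ∞ M]
  {F : Type*} [NormedAddCommGroup F] [NormedSpace ℝ F]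
  {V : M → Type*} [TopologicalSpace (TotalSpace F V)]
  [∀ x, NormedAddCommGroup (V x)] [∀ x, InnerProductSpace ℝ (V x)]
  [FiberBundle F V] [VectorBundle ℝ F V]

omit [IsManifold (𝓡 6) ∞ M] [∀ x, InnerProductSpace ℝ (V x)] [VectorBundle ℝ F V] in
lemma SmoothSection.mdifferentiableAt {s : ∀ x, V x} (hs : SmoothSection F s) (x : M) :
    MDifferentiableAt (𝓡 6) ((𝓡 6).prod 𝓘(ℝ, F)) (fun x => TotalSpace.mk' F x (s x)) x :=
  (hs x).mdifferentiableAt (by simp)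

/-- Every vector in a fibre is the value of a globally defined smooth section. -/
lemma exists_smoothSection_eq [T2Space M] [ContMDiffVectorBundle ∞ F V (𝓡 6)]
    [FiniteDimensional ℝ F] (x : M) (v : V x) :
    ∃ s : ∀ y, V y, SmoothSection F s ∧ s x = v := by
  let t := trivializationAt F V x
  let b := Module.finBasis ℝ F
  have hx : x ∈ t.baseSet := FiberBundle.mem_baseSet_trivializationAt' x
  obtain ⟨χ, -, hχ⟩ := (SmoothBumpFunction.nhds_basis_tsupport (I := 𝓡 6) x).mem_iff.mp
    (t.open_baseSet.mem_nhds hx)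
  refine ⟨(χ : M → ℝ) • fun y => ∑ i, ((t.basisAt b hx).repr v i) • t.localFrame b i y, ?_, ?_⟩
  · refine ContMDiffOn.smul_section_of_tsupport χ.contMDiff.contMDiffOn t.open_baseSet hχ
      (ContMDiffOn.sum_section fun i _ => ContMDiffOn.const_smul_section
        ((t.isLocalFrameOn_localFrame_baseSet (𝓡 6) ∞ b).contMDiffOn i))
  · simp only [Pi.smul_apply', χ.eq_one, one_smul]
    conv_rhs => rw [← (t.basisAt b hx).sum_repr v]
    exact Finset.sum_congr rfl fun i _ => by rw [t.localFrame_apply_of_mem_baseSet b hx]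

variable (D : CovariantDerivative (𝓡 6) E6 (fun x : M => TangentSpace (𝓡 6) x))
  (DV : CovariantDerivative (𝓡 6) F V)

/-- The second covariant derivative `∇²_{Y,Z} s = ∇_Y ∇_Z s - ∇_{∇_Y Z} s` of a section `s`. -/
def covHess (Y Z : ∀ x : M, TangentSpace (𝓡 6) x) (s : ∀ x, V x) (x : M) : V x :=
  DV (fun y => DV s y (Z y)) x (Y x) - DV s x (D Z x (Y x))

/-- The curvature `R(Y, Z) s = ∇²_{Y,Z} s - ∇²_{Z,Y} s`; for a torsion-free connection `D` this is
`∇_Y ∇_Z s - ∇_Z ∇_Y s - ∇_{[Y,Z]} s`. -/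
def curv (Y Z : ∀ x : M, TangentSpace (𝓡 6) x) (s : ∀ x, V x) (x : M) : V x :=
  covHess D DV Y Z s x - covHess D DV Z Y s x

variable {D DV}

lemma cov_add {s t : ∀ x, V x} (hs : SmoothSection F s) (ht : SmoothSection F t) (x : M) :
    DV (fun y => s y + t y) x = DV s x + DV t x :=
  DV.isCovariantDerivativeOnUniv.add (hs.mdifferentiableAt x) (ht.mdifferentiableAt x)

lemma cov_smul {s : ∀ x, V x} (hs : SmoothSection F s) (c : ℝ) (x : M) :
    DV (fun y => c • s y) x = c • DV s x :=
  DV.isCovariantDerivativeOnUniv.smul_const c (hs.mdifferentiableAt x)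

lemma cov_sub {s t : ∀ x, V x} (hs : SmoothSection F s) (ht : SmoothSection F t) (x : M) :
    DV (fun y => s y - t y) x = DV s x - DV t x := by
  have h1 := cov_add (DV := DV) (ht.const_smul_section (a := (-1 : ℝ))) hs x
  have h2 := cov_smul (DV := DV) ht (-1) x
  have h3 : (fun y => s y - t y) = fun y => (((-1 : ℝ) • t) y) + s y := by
    ext1 y
    simp only [Pi.smul_apply]
    module
  rw [h3, h1]
  change DV (fun y => (-1 : ℝ) • t y) x + _ = _
  rw [h2]
  module

lemma cov_sum {ι : Type*} (A : Finset ι) {s : ι → ∀ x, V x} (hs : ∀ i, SmoothSection F (s i))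
    (x : M) : DV (fun y => ∑ i ∈ A, s i y) x = ∑ i ∈ A, DV (s i) x := by
  classical
  induction A using Finset.induction_on with
  | empty =>
    simp only [Finset.sum_empty]
    exact DV.isCovariantDerivativeOnUniv.zero
  | insert i A hi ih =>
    simp only [Finset.sum_insert hi]
    rw [cov_add (hs i) (ContMDiff.sum_section fun j _ => hs j), ih]

lemma smoothSection_cov [ContMDiffVectorBundle ∞ F V (𝓡 6)]
    (hDV : CovariantDerivative.ContMDiffCovariantDerivative DV ∞)
    {s : ∀ x, V x} (hs : SmoothSection F s)
    {Y : ∀ x : M, TangentSpace (𝓡 6) x} (hY : SmoothField Y) :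
    SmoothSection F (fun x => DV s x (Y x)) := by
  have h1 := hDV.contMDiff.contMDiff (σ := s) (by simpa using hs.contMDiffOn)
  rw [contMDiffOn_univ] at h1
  exact ContMDiff.clm_bundle_apply (F₁ := E6) (F₂ := F)
    (E₁ := fun x : M => TangentSpace (𝓡 6) x) (E₂ := V) h1 hY

section LeviCivita

variable [RiemannianBundle (fun x : M => TangentSpace (𝓡 6) x)]
  [IsContMDiffRiemannianBundle (𝓡 6) ∞ E6 (fun x : M => TangentSpace (𝓡 6) x)]

lemma IsLeviCivita.sub_eq_mlieBracket (hD : IsLeviCivita D)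
    {Y Z : ∀ x : M, TangentSpace (𝓡 6) x} (hY : SmoothField Y) (hZ : SmoothField Z) (x : M) :
    D Z x (Y x) - D Y x (Z x) = mlieBracket (𝓡 6) Y Z x :=
  D.torsion_eq_zero_iff.mp hD.torsion_free (hY.mdifferentiableAt x) (hZ.mdifferentiableAt x)

/-- The Hessian of a function with respect to a torsion-free connection is symmetric. -/
lemma IsLeviCivita.hessian_symm (hD : IsLeviCivita D) {f : M → ℝ}
    (hf : ContMDiff (𝓡 6) 𝓘(ℝ, ℝ) ∞ f)
    {Y Z : ∀ x : M, TangentSpace (𝓡 6) x} (hY : SmoothField Y) (hZ : SmoothField Z) {x : M}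
    (hYx : Y x ≠ 0) :
    mvfderiv (𝓡 6) (fun y => mvfderiv (𝓡 6) f y (Z y)) x (Y x) - mvfderiv (𝓡 6) f x (D Z x (Y x))
    = mvfderiv (𝓡 6) (fun y => mvfderiv (𝓡 6) f y (Y y)) x (Z x)
      - mvfderiv (𝓡 6) f x (D Y x (Z x)) := by
  have h1 := mvfderiv_mlieBracket hf hY hZ x hY hYx
  rw [← hD.sub_eq_mlieBracket hY hZ, map_sub] at h1
  linarith

/-- The first Bianchi identity, from the Jacobi identity. -/
lemma IsLeviCivita.bianchi (hD : IsLeviCivita D)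
    {Y Z W : ∀ x : M, TangentSpace (𝓡 6) x} (hY : SmoothField Y) (hZ : SmoothField Z)
    (hW : SmoothField W) (x : M) :
    curv D D Y Z W x + curv D D Z W Y x + curv D D W Y Z x = 0 := by
  have : IsManifold (𝓡 6) (minSmoothness ℝ 3) M :=
    IsManifold.of_le (n := ∞) (by simp only [minSmoothness_of_isRCLikeNormedField]; norm_cast)
  have le2 : minSmoothness ℝ 2 ≤ (∞ : WithTop ℕ∞) := by
    simp only [minSmoothness_of_isRCLikeNormedField]; norm_cast
  have J := leibniz_identity_mlieBracket_apply (I := 𝓡 6) ((hY x).of_le le2) ((hZ x).of_le le2)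
    ((hW x).of_le le2)
  have hbr : ∀ {U U' : ∀ x : M, TangentSpace (𝓡 6) x}, SmoothField U → SmoothField U' →
      mlieBracket (𝓡 6) U U' = fun y => D U' y (U y) - D U y (U' y) := by
    intro U U' hU hU'
    ext1 y
    exact (hD.sub_eq_mlieBracket hU hU' y).symm
  have hc : ∀ {U U' : ∀ x : M, TangentSpace (𝓡 6) x}, SmoothField U → SmoothField U' →
      SmoothField (fun y => D U y (U' y)) := fun hU hU' => smoothSection_cov hD.smooth hU hU'
  have hs : ∀ {U U' : ∀ x : M, TangentSpace (𝓡 6) x}, SmoothField U → SmoothField U' →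
      SmoothField (fun y => D U' y (U y) - D U y (U' y)) := fun hU hU' =>
    (hc hU' hU).sub_section (hc hU hU')
  rw [hbr hZ hW, hbr hY hZ, hbr hY hW, hbr hY (hs hZ hW), hbr (hs hY hZ) hW, hbr hZ (hs hY hW)]
    at J
  simp only at J
  rw [cov_sub (hc hW hZ) (hc hZ hW), cov_sub (hc hZ hY) (hc hY hZ), cov_sub (hc hW hY) (hc hY hW)]
    at J
  simp only [sub_apply, map_sub] at J
  rw [← sub_eq_zero] at J
  simp only [curv, covHess]
  rw [← J]
  abel

variable [FiniteDimensional ℝ F] [ContMDiffVectorBundle ∞ F V (𝓡 6)]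
  [IsContMDiffRiemannianBundle (𝓡 6) ∞ F V]

omit [RiemannianBundle (fun x : M => TangentSpace (𝓡 6) x)]
  [IsContMDiffRiemannianBundle (𝓡 6) ∞ E6 (fun x : M => TangentSpace (𝓡 6) x)] in
lemma mvfderiv_inner (hm : DV.IsMetricCompatible) {s t : ∀ x, V x} (hs : SmoothSection F s)
    (ht : SmoothSection F t) {Y : ∀ x : M, TangentSpace (𝓡 6) x} (x : M) :
    mvfderiv (𝓡 6) (fun y => (inner ℝ (s y) (t y) : ℝ)) x (Y x)
      = inner ℝ (DV s x (Y x)) (t x) + inner ℝ (s x) (DV t x (Y x)) :=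
  hm.mvfderiv_inner_eq Y (hs.mdifferentiableAt x) (ht.mdifferentiableAt x)

/-- The Hessian of the inner product of two sections. -/
lemma hessian_inner (hm : DV.IsMetricCompatible)
    (hDV : CovariantDerivative.ContMDiffCovariantDerivative DV ∞)
    {s t : ∀ x, V x} (hs : SmoothSection F s) (ht : SmoothSection F t)
    {Y Z : ∀ x : M, TangentSpace (𝓡 6) x} (hZ : SmoothField Z) (x : M) :
    mvfderiv (𝓡 6) (fun y => mvfderiv (𝓡 6) (fun y => (inner ℝ (s y) (t y) : ℝ)) y (Z y)) x (Y x)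
      - mvfderiv (𝓡 6) (fun y => (inner ℝ (s y) (t y) : ℝ)) x (D Z x (Y x))
    = inner ℝ (covHess D DV Y Z s x) (t x) + inner ℝ (DV s x (Z x)) (DV t x (Y x))
      + inner ℝ (DV s x (Y x)) (DV t x (Z x)) + inner ℝ (s x) (covHess D DV Y Z t x) := by
  have h1 : (fun y => mvfderiv (𝓡 6) (fun y => (inner ℝ (s y) (t y) : ℝ)) y (Z y))
      = (fun y => (inner ℝ (DV s y (Z y)) (t y) : ℝ))
        + (fun y => (inner ℝ (s y) (DV t y (Z y)) : ℝ)) := by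
    ext1 y
    exact mvfderiv_inner hm hs ht y
  have hsZ := smoothSection_cov hDV hs hZ
  have htZ := smoothSection_cov hDV ht hZ
  rw [h1, mvfderiv_add ((hsZ.inner_bundle ht).mdifferentiable (by simp) x)
    ((hs.inner_bundle htZ).mdifferentiable (by simp) x), add_apply,
    mvfderiv_inner hm hsZ ht, mvfderiv_inner hm hs htZ]
  have h2 := mvfderiv_inner hm hs ht (Y := fun y => D Z y (Y y)) x
  rw [h2]
  simp only [covHess, inner_sub_left, inner_sub_right]
  ring

/-- The curvature operators of a metric connection are skew. -/
lemma inner_curv (hD : IsLeviCivita D) (hm : DV.IsMetricCompatible)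
    (hDV : CovariantDerivative.ContMDiffCovariantDerivative DV ∞)
    {s t : ∀ x, V x} (hs : SmoothSection F s) (ht : SmoothSection F t)
    {Y Z : ∀ x : M, TangentSpace (𝓡 6) x} (hY : SmoothField Y) (hZ : SmoothField Z) {x : M}
    (hYx : Y x ≠ 0) :
    (inner ℝ (curv D DV Y Z s x) (t x) : ℝ) = -inner ℝ (s x) (curv D DV Y Z t x) := by
  have h1 := hD.hessian_symm (hs.inner_bundle ht) hY hZ hYx
  rw [hessian_inner hm hDV hs ht hZ, hessian_inner hm hDV hs ht hY] at h1
  simp only [curv, inner_sub_left, inner_sub_right]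
  linarith

end LeviCivita

omit [FiberBundle F V] [VectorBundle ℝ F V] [TopologicalSpace M] [ChartedSpace E6 M]
  [IsManifold (𝓡 6) ∞ M] [TopologicalSpace (TotalSpace F V)] [NormedAddCommGroup F]
  [NormedSpace ℝ F] in
/-- An operation on sections with values in the fibre over `x` which is formally skew at `x` is
tensorial: it is given by a skew linear operator on the fibre. -/
lemma exists_linearMap_of_skew {x : M} (P : (∀ y, V y) → Prop)
    (hext : ∀ v : V x, ∃ s : ∀ y, V y, P s ∧ s x = v) (Φ : (∀ y, V y) → V x)
    (hΦ : ∀ s t, P s → P t → (inner ℝ (Φ s) (t x) : ℝ) = -inner ℝ (s x) (Φ t)) :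
    ∃ A : V x →ₗ[ℝ] V x, (∀ s, P s → A (s x) = Φ s) ∧
      ∀ u v, (inner ℝ (A u) v : ℝ) = -inner ℝ u (A v) := by
  choose ext hP hval using hext
  have key : ∀ s, P s → ∀ w, (inner ℝ (Φ s) w : ℝ) = -inner ℝ (s x) (Φ (ext w)) := by
    intro s hs w
    have := hΦ s (ext w) hs (hP w)
    rwa [hval] at this
  let A : V x →ₗ[ℝ] V x :=
    { toFun := fun v => Φ (ext v)
      map_add' := fun u v => by
        refine ext_inner_right ℝ fun w => ?_
        rw [inner_add_left, key _ (hP _), key _ (hP _), key _ (hP _), hval, hval, hval,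
          inner_add_left]
        ring
      map_smul' := fun c u => by
        refine ext_inner_right ℝ fun w => ?_
        rw [RingHom.id_apply, inner_smul_left, key _ (hP _), key _ (hP _), hval, hval,
          inner_smul_left]
        ring }
  refine ⟨A, fun s hs => ?_, fun u v => ?_⟩
  · refine ext_inner_right ℝ fun w => ?_
    change inner ℝ (Φ (ext (s x))) w = _
    rw [key _ (hP _), key s hs, hval]
  · change inner ℝ (Φ (ext u)) v = -inner ℝ u (Φ (ext v))
    rw [key _ (hP _), hval]

end Hessian

/-! ### The Lichnerowicz formula for a nearly Kähler manifold -/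

section Lichnerowicz

variable {M : Type*} [TopologicalSpace M] [ChartedSpace E6 M] [IsManifold (𝓡 6) ∞ M]
  [RiemannianBundle (fun x : M => TangentSpace (𝓡 6) x)]
  [IsContMDiffRiemannianBundle (𝓡 6) ∞ E6 (fun x : M => TangentSpace (𝓡 6) x)]
  {S : M → Type*} [TopologicalSpace (Bundle.TotalSpace E8 S)]
  [∀ x, NormedAddCommGroup (S x)] [∀ x, InnerProductSpace ℝ (S x)]
  [FiberBundle E8 S] [VectorBundle ℝ E8 S] [ContMDiffVectorBundle ∞ E8 S (𝓡 6)]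
  [IsContMDiffRiemannianBundle (𝓡 6) ∞ E8 S]

/-- An orthonormal family of six tangent vectors as an orthonormal basis. -/
lemma exists_orthonormalBasis_of_orthonormal {x : M} {v : Fin 6 → TangentSpace (𝓡 6) x}
    (hv : Orthonormal ℝ v) :
    ∃ e : OrthonormalBasis (Fin 6) ℝ (TangentSpace (𝓡 6) x), ∀ a, e a = v a := by
  have hfin : Module.finrank ℝ (TangentSpace (𝓡 6) x) = 6 := by
    change Module.finrank ℝ E6 = 6
    simp
  let b := basisOfOrthonormalOfCardEqFinrank hv (by simp [hfin])
  have hb : ⇑b = v := coe_basisOfOrthonormalOfCardEqFinrank hv _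
  exact ⟨b.toOrthonormalBasis (by rw [hb]; exact hv), fun a => by
    rw [Module.Basis.coe_toOrthonormalBasis, hb]⟩

lemma finrank_spinor (x : M) : Module.finrank ℝ (S x) = 8 := by
  rw [((trivializationAt E8 S x).linearEquivAt ℝ x
    (FiberBundle.mem_baseSet_trivializationAt' x)).finrank_eq]
  simp

namespace RealSpinorBundle

variable (σ : RealSpinorBundle M S)

lemma cl_add_cl (x : M) (v w : TangentSpace (𝓡 6) x) (s : S x) :
    σ.cl x v (σ.cl x w s) = -σ.cl x w (σ.cl x v s) - (2 * inner ℝ v w : ℝ) • s := by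
  have h := σ.cl_cl x (v + w) s
  simp only [map_add, add_apply, σ.cl_cl, inner_add_left, inner_add_right,
    real_inner_comm v w] at h
  rw [← sub_eq_zero] at h ⊢
  rw [← h]
  module

lemma isCliffordFrame {x : M} {v : Fin 6 → TangentSpace (𝓡 6) x} (hv : Orthonormal ℝ v) :
    IsCliffordFrame (fun a => (σ.cl x (v a)).toLinearMap) where
  sq a s := by
    have h := σ.cl_cl x (v a) s
    rw [real_inner_self_eq_norm_sq, hv.1 a] at h
    simpa using h
  anti a b hab s := by
    have h := σ.cl_add_cl x (v a) (v b) s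
    rw [hv.2 hab] at h
    simpa using h
  skew a s t := σ.cl_skew x (v a) s t

lemma smoothSection_cl {X : ∀ x : M, TangentSpace (𝓡 6) x} {s : ∀ x, S x} (hX : SmoothField X)
    (hs : SmoothSection E8 s) : SmoothSection E8 (fun x => σ.cl x (X x) (s x)) :=
  ContMDiff.clm_bundle_apply₂ (F₁ := E6) (F₂ := E8) (F₃ := E8)
    (E₁ := fun x : M => TangentSpace (𝓡 6) x) (E₂ := S) (E₃ := S) σ.contMDiff_cl hX hs

end RealSpinorBundle

variable {σ : RealSpinorBundle M S}
  {D : CovariantDerivative (𝓡 6) E6 (fun x : M => TangentSpace (𝓡 6) x)}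
  {DS : CovariantDerivative (𝓡 6) E8 S}

lemma IsSpinConnection.cov_cl (h : IsSpinConnection σ D DS) {X : ∀ x : M, TangentSpace (𝓡 6) x}
    {s : ∀ x, S x} (hX : SmoothField X) (hs : SmoothSection E8 s) (x : M)
    (v : TangentSpace (𝓡 6) x) :
    DS (fun y => σ.cl y (X y) (s y)) x v = σ.cl x (D X x v) (s x) + σ.cl x (X x) (DS s x v) :=
  h.clifford X s x v (hX.mdifferentiableAt x) (hs.mdifferentiableAt x)

/-- The Leibniz rule for second covariant derivatives and Clifford multiplication. -/
lemma IsSpinConnection.covHess_cl (h : IsSpinConnection σ D DS) (hD : IsLeviCivita D)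
    {X Y Z : ∀ x : M, TangentSpace (𝓡 6) x} {s : ∀ x, S x} (hX : SmoothField X)
    (hZ : SmoothField Z) (hs : SmoothSection E8 s) (x : M) :
    covHess D DS Y Z (fun y => σ.cl y (X y) (s y)) x =
      σ.cl x (covHess D D Y Z X x) (s x) + σ.cl x (D X x (Z x)) (DS s x (Y x))
      + σ.cl x (D X x (Y x)) (DS s x (Z x)) + σ.cl x (X x) (covHess D DS Y Z s x) := by
  have hXZ := smoothSection_cov hD.smooth hX hZ
  have hsZ := smoothSection_cov h.smooth hs hZ
  simp only [covHess, h.cov_cl hX hs]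
  rw [cov_add (σ.smoothSection_cl hXZ hs) (σ.smoothSection_cl hX hsZ), add_apply,
    h.cov_cl hXZ hs, h.cov_cl hX hsZ]
  simp only [map_sub, sub_apply]
  abel

/-- The spin curvature acts on vectors as the Riemannian curvature. -/
lemma IsSpinConnection.curv_cl (h : IsSpinConnection σ D DS) (hD : IsLeviCivita D)
    {X Y Z : ∀ x : M, TangentSpace (𝓡 6) x} {s : ∀ x, S x} (hX : SmoothField X)
    (hY : SmoothField Y) (hZ : SmoothField Z) (hs : SmoothSection E8 s) (x : M) :
    curv D DS Y Z (fun y => σ.cl y (X y) (s y)) x =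
      σ.cl x (curv D D Y Z X x) (s x) + σ.cl x (X x) (curv D DS Y Z s x) := by
  simp only [curv]
  rw [h.covHess_cl hD hX hZ hs, h.covHess_cl hD hX hY hs]
  simp only [map_sub, sub_apply]
  abel

namespace NearlyKahler

variable (N : NearlyKahler M S)

/-- The Killing equation as an identity of sections. -/
lemma cov_ψ (Y : ∀ x : M, TangentSpace (𝓡 6) x) :
    (fun y => N.spinLC N.ψ y (Y y)) = fun y => N.lam • N.spin.cl y (Y y) (N.ψ y) := by
  ext1 y
  exact N.killing y (Y y)

lemma covHess_ψ {Y Z : ∀ x : M, TangentSpace (𝓡 6) x} (hZ : SmoothField Z) (x : M) :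
    covHess N.LC N.spinLC Y Z N.ψ x =
      N.lam ^ 2 • N.spin.cl x (Z x) (N.spin.cl x (Y x) (N.ψ x)) := by
  have hψ : SmoothSection E8 N.ψ := N.contMDiff_ψ
  rw [covHess, N.cov_ψ, cov_smul (N.spin.smoothSection_cl hZ hψ), smul_apply,
    N.isSpinConnection.cov_cl hZ hψ, N.killing, N.killing, map_smul]
  module

/-- The curvature term of the Lichnerowicz formula on a nearly Kähler manifold. -/
lemma sum_cl_cl_curv [T2Space M] {E : Fin 6 → ∀ x : M, TangentSpace (𝓡 6) x}
    (hE : ∀ a, SmoothField (E a)) {x : M} (ho : Orthonormal ℝ (fun a => E a x))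
    {φ : ∀ x, S x} (hφ : SmoothSection E8 φ) :
    ∑ a, ∑ b, N.spin.cl x (E a x) (N.spin.cl x (E b x)
      (curv N.LC N.spinLC (E a) (E b) φ x)) = (60 * N.lam ^ 2) • φ x := by
  have hD := N.isLeviCivita
  have hDS := N.isSpinConnection
  have hψ : SmoothSection E8 N.ψ := N.contMDiff_ψ
  have hne : ∀ a, E a x ≠ 0 := fun a => ho.ne_zero a
  obtain ⟨e, he⟩ := exists_orthonormalBasis_of_orthonormal ho
  have hA : ∀ a b, ∃ A : S x →ₗ[ℝ] S x,
      (∀ s, SmoothSection E8 s → A (s x) = curv N.LC N.spinLC (E a) (E b) s x) ∧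
      ∀ u v, (inner ℝ (A u) v : ℝ) = -inner ℝ u (A v) := by
    intro a b
    exact exists_linearMap_of_skew (fun s => SmoothSection E8 s) (exists_smoothSection_eq x)
      (fun s => curv N.LC N.spinLC (E a) (E b) s x)
      fun s t hs ht => inner_curv hD hDS.metric hDS.smooth hs ht (hE a) (hE b) (hne a)
  choose A hA hskew using hA
  have key := (N.spin.isCliffordFrame ho).sum_curvature_eq (finrank_spinor x) A hskew
    (fun a b c d => inner ℝ (curv N.LC N.LC (E a) (E b) (E c) x) (E d x))
    (fun a b c d => ?_) (fun a b c d => ?_) (fun a b c d => ?_) (fun a b k s => ?_)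
    (N.ψ_ne_zero x) N.lam (fun a b => ?_) (φ x)
  · simpa only [hA _ _ φ hφ, ContinuousLinearMap.coe_coe] using key
  · simp only [curv, inner_sub_left]
    ring
  · rw [inner_curv hD hD.metric hD.smooth (hE c) (hE d) (hE a) (hE b) (hne a), real_inner_comm]
  · rw [← inner_add_left, ← inner_add_left, hD.bianchi (hE a) (hE b) (hE c), inner_zero_left]
  · obtain ⟨t, ht, rfl⟩ := exists_smoothSection_eq (F := E8) x s
    have h1 := hA a b _ (N.spin.smoothSection_cl (hE k) ht)
    simp only [ContinuousLinearMap.coe_coe]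
    rw [h1, hDS.curv_cl hD (hE k) (hE a) (hE b) ht, hA a b t ht, add_comm]
    congr 1
    conv_lhs => rw [← e.sum_repr (curv N.LC N.LC (E a) (E b) (E k) x)]
    rw [map_sum, sum_apply]
    refine Finset.sum_congr rfl fun d _ => ?_
    rw [map_smul, smul_apply, e.repr_apply_apply, he, real_inner_comm]
  · rw [hA a b N.ψ hψ, curv, N.covHess_ψ (hE b), N.covHess_ψ (hE a), smul_sub]
    rfl

/-- The Lichnerowicz formula: `∑ e_a e_b ∇²_{a,b} φ = -∑ ∇²_{a,a} φ + 30 lam² φ`. -/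
lemma lichnerowicz [T2Space M] {E : Fin 6 → ∀ x : M, TangentSpace (𝓡 6) x}
    (hE : ∀ a, SmoothField (E a)) {x : M} (ho : Orthonormal ℝ (fun a => E a x))
    {φ : ∀ x, S x} (hφ : SmoothSection E8 φ) :
    ∑ a, ∑ b, N.spin.cl x (E a x) (N.spin.cl x (E b x)
      (covHess N.LC N.spinLC (E a) (E b) φ x)) =
    -∑ a, covHess N.LC N.spinLC (E a) (E a) φ x + (30 * N.lam ^ 2) • φ x := by
  have h1 := (N.spin.isCliffordFrame ho).sum_mul_mul_eq
    (fun a b => covHess N.LC N.spinLC (E a) (E b) φ x)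
  have h2 := N.sum_cl_cl_curv hE ho hφ
  simp only [curv] at h2
  simp only [ContinuousLinearMap.coe_coe] at h1
  rw [h1, h2]
  module

/-- The covariant derivative of the Dirac equation `∑ e_b ∇_b φ = μ φ`. The derivatives of the
orthonormal frame, which form a skew matrix, cancel. -/
lemma sum_cl_covHess {E : Fin 6 → ∀ x : M, TangentSpace (𝓡 6) x}
    (hE : ∀ a, SmoothField (E a)) {U : Set M} (hU : IsOpen U)
    (ho : ∀ y ∈ U, Orthonormal ℝ (fun a => E a y))
    {φ : ∀ x, S x} (hφ : SmoothSection E8 φ) {μ : ℝ}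
    (hdirac : ∀ y ∈ U, ∑ b, N.spin.cl y (E b y) (N.spinLC φ y (E b y)) = μ • φ y)
    {x : M} (hx : x ∈ U) (a : Fin 6) :
    ∑ b, N.spin.cl x (E b x) (covHess N.LC N.spinLC (E a) (E b) φ x)
      = μ • N.spinLC φ x (E a x) := by
  have hD := N.isLeviCivita
  have hDS := N.isSpinConnection
  have hφE : ∀ b, SmoothSection E8 (fun y => N.spinLC φ y (E b y)) := fun b =>
    smoothSection_cov hDS.smooth hφ (hE b)
  have hcl : ∀ b, SmoothSection E8 (fun y => N.spin.cl y (E b y) (N.spinLC φ y (E b y))) :=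
    fun b => N.spin.smoothSection_cl (hE b) (hφE b)
  have h1 : N.spinLC (fun y => ∑ b, N.spin.cl y (E b y) (N.spinLC φ y (E b y))) x
      = N.spinLC (fun y => μ • φ y) x :=
    N.spinLC.isCovariantDerivativeOn.congr_of_eqOn
      ((show SmoothSection E8 (fun y => ∑ b, N.spin.cl y (E b y) (N.spinLC φ y (E b y))) from
        ContMDiff.sum_section fun b _ => hcl b).mdifferentiableAt x)
      ((show SmoothSection E8 (fun y => μ • φ y) from hφ.const_smul_section).mdifferentiableAt x)
      (hU.mem_nhds hx) hdirac
  have h2 := congrArg (fun L => L (E a x)) h1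
  simp only [cov_sum _ hcl, cov_smul hφ, sum_apply, smul_apply,
    hDS.cov_cl (hE _) (hφE _), Finset.sum_add_distrib] at h2
  obtain ⟨e, he⟩ := exists_orthonormalBasis_of_orthonormal (ho x hx)
  let w : Fin 6 → Fin 6 → ℝ := fun b c => inner ℝ (E c x) (N.LC (E b) x (E a x))
  have hw : ∀ b c, w b c = -w c b := by
    intro b c
    have h3 := mvfderiv_inner hD.metric (hE b) (hE c) (Y := E a) x
    have h4 : HasMFDerivAt (𝓡 6) 𝓘(ℝ, ℝ) (fun y => (inner ℝ (E b y) (E c y) : ℝ)) x 0 := by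
      refine (hasMFDerivAt_const (if b = c then (1 : ℝ) else 0) x).congr_of_eventuallyEq ?_
      filter_upwards [hU.mem_nhds hx] with y hy
      exact orthonormal_iff_ite.mp (ho y hy) b c
    simp only [mvfderiv, h4.mfderiv] at h3
    rw [ContinuousLinearMap.comp_zero, zero_apply, real_inner_comm] at h3
    simp only [w]
    linarith
  have hexp : ∀ b, N.LC (E b) x (E a x) = ∑ c, w b c • E c x := by
    intro b
    conv_lhs => rw [← e.sum_repr (N.LC (E b) x (E a x))]
    exact Finset.sum_congr rfl fun c _ => by rw [e.repr_apply_apply, he]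
  have h5 : ∑ b, N.spin.cl x (E b x) (N.spinLC φ x (N.LC (E b) x (E a x)))
      + ∑ b, N.spin.cl x (N.LC (E b) x (E a x)) (N.spinLC φ x (E b x)) = 0 := by
    simp only [hexp, map_sum, map_smul, sum_apply, smul_apply]
    rw [Finset.sum_comm (f := fun b c => w b c • N.spin.cl x (E c x) (N.spinLC φ x (E b x))),
      ← Finset.sum_add_distrib]
    refine Finset.sum_eq_zero fun b _ => ?_
    rw [← Finset.sum_add_distrib]
    refine Finset.sum_eq_zero fun c _ => ?_
    rw [hw b c]
    module
  simp only [covHess, map_sub, Finset.sum_sub_distrib]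
  rw [← h2, ← sub_eq_zero]
  rw [← neg_eq_zero, ← h5]
  abel

/-- The squared norm of an eigenspinor with eigenvalue `4 lam` of the Dirac operator satisfies
`½ Δ |φ|² = ∑ |∇_a φ|² + 14 lam² |φ|²`, so that it vanishes where it has a local maximum. -/
theorem eq_zero_of_isLocalMax [T2Space M] {φ : ∀ x, S x} (hφ : SmoothSection E8 φ)
    (hdirac : ∀ (x : M) (e : OrthonormalBasis (Fin 6) ℝ (TangentSpace (𝓡 6) x)),
      ∑ b, N.spin.cl x (e b) (N.spinLC φ x (e b)) = (4 * N.lam) • φ x)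
    {x : M} (hmax : IsLocalMax (fun y => (inner ℝ (φ y) (φ y) : ℝ)) x) : φ x = 0 := by
  have hD := N.isLeviCivita
  have hDS := N.isSpinConnection
  obtain ⟨E, U, hE, hU, hx, ho⟩ := exists_orthonormal_frame x
  have hdirac' : ∀ y ∈ U, ∑ b, N.spin.cl y (E b y) (N.spinLC φ y (E b y))
      = (4 * N.lam) • φ y := by
    intro y hy
    obtain ⟨e, he⟩ := exists_orthonormalBasis_of_orthonormal (ho y hy)
    simpa only [he] using hdirac y e
  have h1 : ∑ a, ∑ b, N.spin.cl x (E a x) (N.spin.cl x (E b x)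
      (covHess N.LC N.spinLC (E a) (E b) φ x)) = (16 * N.lam ^ 2) • φ x := by
    simp only [← map_sum, N.sum_cl_covHess hE hU ho hφ hdirac' hx, map_smul]
    rw [← Finset.smul_sum, hdirac' x hx]
    module
  rw [N.lichnerowicz hE (ho x hx) hφ] at h1
  have h2 : ∑ a, covHess N.LC N.spinLC (E a) (E a) φ x = (14 * N.lam ^ 2) • φ x := by
    rw [← sub_eq_zero] at h1 ⊢
    rw [← neg_eq_zero, ← h1]
    module
  have h3 : ∀ a, (inner ℝ (covHess N.LC N.spinLC (E a) (E a) φ x) (φ x) : ℝ)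
      + ‖N.spinLC φ x (E a x)‖ ^ 2 ≤ 0 := by
    intro a
    have hf := hφ.inner_bundle hφ
    have h4 := hessian_inner (D := N.LC) hDS.metric hDS.smooth hφ hφ (Y := E a) (hE a) x
    have h5 := (hmax.mvfderiv_mvfderiv_nonpos hf (hE a)).2
    have h6 := (hmax.mvfderiv_mvfderiv_nonpos hf (smoothSection_cov hD.smooth (hE a) (hE a))).1
    rw [h6, real_inner_comm (covHess N.LC N.spinLC (E a) (E a) φ x) (φ x),
      real_inner_self_eq_norm_sq] at h4
    linarith
  have h7 : (14 * N.lam ^ 2) * ‖φ x‖ ^ 2 + ∑ a, ‖N.spinLC φ x (E a x)‖ ^ 2 ≤ 0 := by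
    have := Finset.sum_nonpos fun a (_ : a ∈ Finset.univ) => h3 a
    rwa [Finset.sum_add_distrib, ← sum_inner, h2, inner_smul_left,
      real_inner_self_eq_norm_sq, conj_trivial] at this
  have h8 : 0 ≤ ∑ a, ‖N.spinLC φ x (E a x)‖ ^ 2 := Finset.sum_nonneg fun a _ => by positivity
  have h9 : 0 < N.lam ^ 2 := by have := N.lam_ne_zero; positivity
  by_contra hne
  have h10 : 0 < ‖φ x‖ ^ 2 := by have := norm_pos_iff.mpr hne; positivity
  nlinarith [mul_pos h9 h10]

/-- On a compact nearly Kähler manifold the Dirac operator has no eigenspinors with eigenvalue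
`4 lam`. -/
theorem eq_zero_of_dirac [T2Space M] [CompactSpace M] {φ : ∀ x, S x} (hφ : SmoothSection E8 φ)
    (hdirac : ∀ (x : M) (e : OrthonormalBasis (Fin 6) ℝ (TangentSpace (𝓡 6) x)),
      ∑ b, N.spin.cl x (e b) (N.spinLC φ x (e b)) = (4 * N.lam) • φ x) (x : M) : φ x = 0 := by
  have hc : Continuous (fun y => (inner ℝ (φ y) (φ y) : ℝ)) := (hφ.inner_bundle hφ).continuous
  obtain ⟨x₀, -, hx₀⟩ := isCompact_univ.exists_isMaxOn ⟨x, Set.mem_univ x⟩ hc.continuousOn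
  have h0 := N.eq_zero_of_isLocalMax hφ hdirac (hx₀.isLocalMax Filter.univ_mem)
  have h1 : (inner ℝ (φ x) (φ x) : ℝ) ≤ inner ℝ (φ x₀) (φ x₀) := hx₀ (Set.mem_univ x)
  rw [h0, inner_zero_left] at h1
  exact inner_self_eq_zero.mp (le_antisymm h1 real_inner_self_nonneg)

end NearlyKahler

end Lichnerowicz

/-! ### Pull-back and exterior derivative of one-forms -/

section Forms

variable {EM : Type*} [NormedAddCommGroup EM] [NormedSpace ℝ EM]
  {M : Type*} [TopologicalSpace M] [ChartedSpace EM M] [IsManifold 𝓘(ℝ, EM) ∞ M]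
  {EP : Type*} [NormedAddCommGroup EP] [NormedSpace ℝ EP]
  {P : Type*} [TopologicalSpace P] [ChartedSpace EP P] [IsManifold 𝓘(ℝ, EP) ∞ P]
  {V : Type*} [NormedAddCommGroup V] [NormedSpace ℝ V]

/-- The pull-back of a smooth one-form by a map which is smooth on an open set is smooth there. -/
lemma SmoothOneForm.contMDiffOn_pullback {φ : ∀ p : P, TangentSpace 𝓘(ℝ, EP) p →L[ℝ] V}
    (hφ : SmoothOneForm φ) {f : M → P} {U : Set M} (hU : IsOpen U)
    (hf : ContMDiffOn 𝓘(ℝ, EM) 𝓘(ℝ, EP) ∞ f U) :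
    ContMDiffOn 𝓘(ℝ, EM).tangent 𝓘(ℝ, V) ∞
      (fun w : TangentBundle 𝓘(ℝ, EM) M =>
        φ (f w.1) (mfderiv 𝓘(ℝ, EM) 𝓘(ℝ, EP) f w.1 w.2))
      (π EM (TangentSpace 𝓘(ℝ, EM)) ⁻¹' U) := by
  have h1 := hf.contMDiffOn_tangentMapWithin (m := ∞) (by simp) hU.uniqueMDiffOn
  refine (hφ.comp_contMDiffOn h1).congr fun w hw => ?_
  have : mfderivWithin 𝓘(ℝ, EM) 𝓘(ℝ, EP) f U w.1 = mfderiv 𝓘(ℝ, EM) 𝓘(ℝ, EP) f w.1 :=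
    mfderivWithin_of_isOpen hU hw
  change _ = φ (f w.1) (mfderivWithin 𝓘(ℝ, EM) 𝓘(ℝ, EP) f U w.1 w.2)
  rw [this]

lemma contDiffOn_oneFormInChart [FiniteDimensional ℝ EP]
    {φ : ∀ p : P, TangentSpace 𝓘(ℝ, EP) p →L[ℝ] V} (hφ : SmoothOneForm φ) (p : P) :
    ContDiffOn ℝ ∞ (oneFormInChart φ p) (chartAt EP p).target := by
  rw [contDiffOn_clm_apply]
  intro v
  rw [← contMDiffOn_iff_contDiffOn]
  have h := hφ.contMDiffOn_pullback (chartAt EP p).open_target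
    (contMDiffOn_chart_symm (I := 𝓘(ℝ, EP)) (n := ∞) (x := p))
  have hv : ContMDiffOn 𝓘(ℝ, EP) 𝓘(ℝ, EP).tangent ∞
      (fun y => TotalSpace.mk' EP (E := fun y : EP => TangentSpace 𝓘(ℝ, EP) y) y v)
      (chartAt EP p).target :=
    contMDiffOn_vectorSpace_iff_contDiffOn.2 contDiffOn_const
  exact h.comp hv fun y hy => hy

lemma differentiableAt_oneFormInChart [FiniteDimensional ℝ EP]
    {φ : ∀ p : P, TangentSpace 𝓘(ℝ, EP) p →L[ℝ] V} (hφ : SmoothOneForm φ) (p : P) :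
    DifferentiableAt ℝ (oneFormInChart φ p) (chartAt EP p p) :=
  ((contDiffOn_oneFormInChart hφ p).contDiffAt
    ((chartAt EP p).open_target.mem_nhds (mem_chart_target EP p))).differentiableAt (by simp)

/-- The exterior derivative of a one-form in coordinates. -/
lemma extDerivOneForm_eq_sub [FiniteDimensional ℝ EP]
    {φ : ∀ p : P, TangentSpace 𝓘(ℝ, EP) p →L[ℝ] V} (hφ : SmoothOneForm φ) (p : P)
    (u w : TangentSpace 𝓘(ℝ, EP) p) :
    extDerivOneForm φ p u w =
      fderiv ℝ (oneFormInChart φ p) (chartAt EP p p) (mvfderiv 𝓘(ℝ, EP) (chartAt EP p) p u)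
        (mvfderiv 𝓘(ℝ, EP) (chartAt EP p) p w)
      - fderiv ℝ (oneFormInChart φ p) (chartAt EP p p) (mvfderiv 𝓘(ℝ, EP) (chartAt EP p) p w)
        (mvfderiv 𝓘(ℝ, EP) (chartAt EP p) p u) := by
  have hd := differentiableAt_oneFormInChart hφ p
  have hd' : DifferentiableAt ℝ (fun y : EP => ContinuousAlternatingMap.ofSubsingleton ℝ EP V
      (0 : Fin 1) (oneFormInChart φ p y)) (chartAt EP p p) :=
    (ContinuousAlternatingMap.ofSubsingletonLIE (𝕜 := ℝ) (E := EP) (F := V)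
      (0 : Fin 1)).differentiable.differentiableAt.comp _ hd
  rw [extDerivOneForm, extDeriv_apply hd', Fin.sum_univ_two]
  have key : ∀ a b : EP, fderiv ℝ (fun y => oneFormInChart φ p y a) (chartAt EP p p) b
      = fderiv ℝ (oneFormInChart φ p) (chartAt EP p p) b a := by
    intro a b
    rw [fderiv_clm_apply hd (by fun_prop)]
    simp
  rw [← key, ← key]
  simp [Fin.removeNth, sub_eq_add_neg]

/-- Composition with a continuous linear map commutes with the exterior derivative. -/
lemma extDerivOneForm_clm_comp [FiniteDimensional ℝ EP] {W : Type*} [NormedAddCommGroup W]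
    [NormedSpace ℝ W] (l : V →L[ℝ] W)
    {φ : ∀ p : P, TangentSpace 𝓘(ℝ, EP) p →L[ℝ] V} (hφ : SmoothOneForm φ) (p : P)
    (u w : TangentSpace 𝓘(ℝ, EP) p) :
    extDerivOneForm (fun q => l.comp (φ q)) p u w = l (extDerivOneForm φ p u w) := by
  have hl : SmoothOneForm (fun q => l.comp (φ q)) := l.contMDiff.comp hφ
  have hc : oneFormInChart (fun q => l.comp (φ q)) p
      = fun y => (ContinuousLinearMap.compL ℝ EP V W l) (oneFormInChart φ p y) := rfl
  rw [extDerivOneForm_eq_sub hl, extDerivOneForm_eq_sub hφ, map_sub, hc,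
    fderiv_fun_comp _ (by fun_prop) (differentiableAt_oneFormInChart hφ p)]
  simp

/-- The exterior derivative commutes with the pull-back by smooth maps. -/
theorem extDerivOneForm_pullback [FiniteDimensional ℝ EP] [FiniteDimensional ℝ EM]
    {α : ∀ x : M, TangentSpace 𝓘(ℝ, EM) x →L[ℝ] V} (hα : SmoothOneForm α)
    {g : P → M} (hg : ContMDiff 𝓘(ℝ, EP) 𝓘(ℝ, EM) ∞ g) (p : P)
    (u w : TangentSpace 𝓘(ℝ, EP) p) :
    extDerivOneForm (fun q => (α (g q)).comp (mfderiv 𝓘(ℝ, EP) 𝓘(ℝ, EM) g q)) p u w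
      = extDerivOneForm α (g p) (mfderiv 𝓘(ℝ, EP) 𝓘(ℝ, EM) g p u)
        (mfderiv 𝓘(ℝ, EP) 𝓘(ℝ, EM) g p w) := by
  set cP := chartAt EP p with hcP
  set cM := chartAt EM (g p) with hcM
  set f : EP → EM := fun y => cM (g (cP.symm y)) with hf
  have hpP : p ∈ cP.source := mem_chart_source EP p
  have hpM : g p ∈ cM.source := mem_chart_source EM (g p)
  have hsymm : cP.symm (cP p) = p := cP.left_inv hpP
  -- the set of coordinates at which both charts are available
  set U : Set EP := cP.target ∩ cP.symm ⁻¹' (g ⁻¹' cM.source) with hU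
  have hUo : IsOpen U := cP.isOpen_inter_preimage_symm (cM.open_source.preimage hg.continuous)
  have hcU : cP p ∈ U := ⟨cP.map_source hpP, by simpa [hsymm] using hpM⟩
  have hsP : ∀ y ∈ U, MDifferentiableAt 𝓘(ℝ, EP) 𝓘(ℝ, EP) cP.symm y := fun y hy =>
    mdifferentiableAt_atlas_symm (chart_mem_atlas EP p) hy.1
  have hgd : MDifferentiable 𝓘(ℝ, EP) 𝓘(ℝ, EM) g := hg.mdifferentiable (by simp)
  have hfs : ContDiffOn ℝ ∞ f U := by
    rw [← contMDiffOn_iff_contDiffOn]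
    refine (contMDiffOn_chart (I := 𝓘(ℝ, EM)) (n := ∞) (x := g p)).comp
      (t := cM.source) (hg.comp_contMDiffOn ((contMDiffOn_chart_symm (I := 𝓘(ℝ, EP)) (n := ∞)
        (x := p)).mono Set.inter_subset_left)) fun y hy => hy.2
  have hfc : ContDiffAt ℝ ∞ f (cP p) := hfs.contDiffAt (hUo.mem_nhds hcU)
  have hfcp : f (cP p) = cM (g p) := by simp only [hf, hsymm]
  -- the value of the form, read in the model space, only depends on the point
  have congr_pt : ∀ {z z' : M} (h : z = z') (L : EP →L[ℝ] EM),
      (show EM →L[ℝ] V from α z).comp L = (show EM →L[ℝ] V from α z').comp L := by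
    rintro z _ rfl L; rfl
  have hform : ∀ y ∈ U, oneFormInChart (fun q => (α (g q)).comp
      (mfderiv 𝓘(ℝ, EP) 𝓘(ℝ, EM) g q)) p y
      = (oneFormInChart α (g p) (f y)).comp (fderiv ℝ f y) := by
    intro y hy
    have hfy : cM.symm (f y) = g (cP.symm y) := cM.left_inv hy.2
    have hfyt : f y ∈ cM.target := cM.map_source hy.2
    have h1 : mfderiv 𝓘(ℝ, EP) 𝓘(ℝ, EM) (g ∘ cP.symm) y
        = (mfderiv 𝓘(ℝ, EP) 𝓘(ℝ, EM) g (cP.symm y)).comp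
          (mfderiv 𝓘(ℝ, EP) 𝓘(ℝ, EP) cP.symm y) := mfderiv_comp y (hgd _) (hsP y hy)
    have hfd : MDifferentiableAt 𝓘(ℝ, EP) 𝓘(ℝ, EM) f y :=
      ((hfs.contDiffAt (hUo.mem_nhds hy)).differentiableAt (by simp)).mdifferentiableAt
    have h2 : mfderiv 𝓘(ℝ, EP) 𝓘(ℝ, EM) (cM.symm ∘ f) y
        = (mfderiv 𝓘(ℝ, EM) 𝓘(ℝ, EM) cM.symm (f y)).comp
          (mfderiv 𝓘(ℝ, EP) 𝓘(ℝ, EM) f y) :=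
      mfderiv_comp y (mdifferentiableAt_atlas_symm (chart_mem_atlas EM (g p)) hfyt) hfd
    have h3 : mfderiv 𝓘(ℝ, EP) 𝓘(ℝ, EM) (cM.symm ∘ f) y
        = mfderiv 𝓘(ℝ, EP) 𝓘(ℝ, EM) (g ∘ cP.symm) y := by
      apply Filter.EventuallyEq.mfderiv_eq
      filter_upwards [hUo.mem_nhds hy] with z hz
      exact cM.left_inv hz.2
    rw [mfderiv_eq_fderiv] at h2
    calc _ = (show EM →L[ℝ] V from α (g (cP.symm y))).comp
          (show EP →L[ℝ] EM from mfderiv 𝓘(ℝ, EP) 𝓘(ℝ, EM) (g ∘ cP.symm) y) := by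
          rw [h1]; rfl
      _ = (show EM →L[ℝ] V from α (cM.symm (f y))).comp
          (show EP →L[ℝ] EM from mfderiv 𝓘(ℝ, EP) 𝓘(ℝ, EM) (cM.symm ∘ f) y) := by
          rw [h3]; exact (congr_pt hfy _).symm
      _ = _ := by rw [h2]; rfl
  have hev : (fun y : EP => ContinuousAlternatingMap.ofSubsingleton ℝ EP V (0 : Fin 1)
      (oneFormInChart (fun q => (α (g q)).comp (mfderiv 𝓘(ℝ, EP) 𝓘(ℝ, EM) g q)) p y))
      =ᶠ[𝓝 (cP p)] fun y => (ContinuousAlternatingMap.ofSubsingleton ℝ EM V (0 : Fin 1)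
        (oneFormInChart α (g p) (f y))).compContinuousLinearMap (fderiv ℝ f y) := by
    filter_upwards [hUo.mem_nhds hcU] with y hy
    rw [hform y hy]
    ext v
    rfl
  have hd' : DifferentiableAt ℝ (fun y : EM => ContinuousAlternatingMap.ofSubsingleton ℝ EM V
      (0 : Fin 1) (oneFormInChart α (g p) y)) (f (cP p)) := by
    rw [hfcp]
    exact (ContinuousAlternatingMap.ofSubsingletonLIE (𝕜 := ℝ) (E := EM) (F := V)
      (0 : Fin 1)).differentiable.differentiableAt.comp _ (differentiableAt_oneFormInChart hα _)
  -- the chain rule for the coordinate expression of `g`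
  have hchain : ∀ v : TangentSpace 𝓘(ℝ, EP) p, fderiv ℝ f (cP p) (mvfderiv 𝓘(ℝ, EP) cP p v)
      = mvfderiv 𝓘(ℝ, EM) cM (g p) (mfderiv 𝓘(ℝ, EP) 𝓘(ℝ, EM) g p v) := by
    intro v
    have hfd : MDifferentiableAt 𝓘(ℝ, EP) 𝓘(ℝ, EM) f (cP p) :=
      (hfc.differentiableAt (by simp)).mdifferentiableAt
    have h1 := mfderiv_comp p hfd
      (mdifferentiableAt_atlas (I := 𝓘(ℝ, EP)) (chart_mem_atlas EP p) hpP)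
    have h2 := mfderiv_comp p
      (mdifferentiableAt_atlas (I := 𝓘(ℝ, EM)) (chart_mem_atlas EM (g p)) hpM)
      (hgd p)
    have h3 : mfderiv 𝓘(ℝ, EP) 𝓘(ℝ, EM) (f ∘ cP) p = mfderiv 𝓘(ℝ, EP) 𝓘(ℝ, EM) (cM ∘ g) p := by
      apply Filter.EventuallyEq.mfderiv_eq
      filter_upwards [cP.open_source.mem_nhds hpP] with q hq
      simp only [hf, Function.comp, cP.left_inv hq]
    change mfderiv 𝓘(ℝ, EP) 𝓘(ℝ, EM) (cM ∘ g) p = _ at h2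
    rw [h1, h2, mfderiv_eq_fderiv] at h3
    exact DFunLike.congr_fun h3 v
  rw [extDerivOneForm, hev.extDeriv_eq, extDeriv_pullback hd' hfc
    (by simp only [minSmoothness_of_isRCLikeNormedField]; norm_cast), hfcp, extDerivOneForm]
  simp only [ContinuousAlternatingMap.compContinuousLinearMap_apply]
  congr 1
  ext i
  fin_cases i
  · exact hchain u
  · exact hchain w

end Forms

/-! ### The exterior derivative and the Levi-Civita connection -/

section CoordField

variable {M : Type*} [TopologicalSpace M] [ChartedSpace E6 M] [IsManifold (𝓡 6) ∞ M]

/-- The vector field with constant components `a` in the preferred chart at `x` (only meaningful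
on the domain of that chart). -/
def coordField (x : M) (a : E6) (z : M) : TangentSpace (𝓡 6) z :=
  mfderiv (𝓡 6) (𝓡 6) (chartAt E6 x).symm (chartAt E6 x z) a

omit [IsManifold (𝓡 6) ∞ M] in
lemma mk'_congr_base {z z' : M} (h : z' = z) (a : E6) :
    TotalSpace.mk' E6 (E := fun x : M => TangentSpace (𝓡 6) x) z' a
      = TotalSpace.mk' E6 (E := fun x : M => TangentSpace (𝓡 6) x) z a := by
  subst h; rfl

lemma mdifferentiableAt_coordField (x : M) (a : E6) :
    MDifferentiableAt (𝓡 6) (𝓡 6).tangent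
      (fun z => TotalSpace.mk' E6 (E := fun x : M => TangentSpace (𝓡 6) x) z (coordField x a z))
      x := by
  set c := chartAt E6 x with hc
  have h1 := (contMDiffOn_chart_symm (I := 𝓡 6) (n := ∞) (x := x)).contMDiffOn_tangentMapWithin
    (m := ∞) (by simp) c.open_target.uniqueMDiffOn
  have hv : ContMDiffOn (𝓡 6) (𝓡 6).tangent ∞
      (fun y => TotalSpace.mk' E6 (E := fun y : E6 => TangentSpace (𝓡 6) y) y a) c.target :=
    contMDiffOn_vectorSpace_iff_contDiffOn.2 contDiffOn_const
  have h2 := (h1.comp hv fun y hy => hy).comp (contMDiffOn_chart (I := 𝓡 6) (n := ∞) (x := x))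
    fun z hz => c.map_source hz
  refine ((h2.contMDiffAt (c.open_source.mem_nhds (mem_chart_source E6 x))).mdifferentiableAt
    (by simp)).congr_of_eventuallyEq ?_
  filter_upwards [c.open_source.mem_nhds (mem_chart_source E6 x)] with z hz
  have h3 : mfderivWithin (𝓡 6) (𝓡 6) c.symm c.target (c z) = mfderiv (𝓡 6) (𝓡 6) c.symm (c z) :=
    mfderivWithin_of_isOpen c.open_target (c.map_source hz)
  refine (mk'_congr_base (c.left_inv hz) _).symm.trans ?_
  change _ = TotalSpace.mk' E6 (E := fun x : M => TangentSpace (𝓡 6) x) (c.symm (c z))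
    (mfderivWithin (𝓡 6) (𝓡 6) c.symm c.target (c z) a)
  rw [h3]
  rfl

lemma coordField_self (x : M) (v : TangentSpace (𝓡 6) x) :
    coordField x (mvfderiv (𝓡 6) (chartAt E6 x) x v) x = v := by
  have h := (mdifferentiable_chart (I := 𝓡 6) x).symm_comp_deriv (mem_chart_source E6 x)
  exact DFunLike.congr_fun h v

lemma mlieBracket_coordField (x : M) (a b : E6) :
    mlieBracket (𝓡 6) (coordField x a) (coordField x b) x = 0 := by
  have hc : ∀ a : E6, ∀ᶠ y in 𝓝 (extChartAt (𝓡 6) x x),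
      mpullbackWithin 𝓘(ℝ, E6) (𝓡 6) (extChartAt (𝓡 6) x).symm (coordField x a)
        (Set.range (𝓡 6)) y = a := by
    intro a
    filter_upwards [extChartAt_target_mem_nhds (I := 𝓡 6) x] with y hy
    have hi := isInvertible_mfderivWithin_extChartAt_symm (I := 𝓡 6) hy
    rw [mpullbackWithin_apply]
    refine (hi.inverse_apply_eq).2 ?_
    have hy' : y ∈ (chartAt E6 x).target := by simpa using hy
    have h1 : chartAt E6 x ((extChartAt (𝓡 6) x).symm y) = y := by
      simpa using (chartAt E6 x).right_inv hy'
    simp only [coordField]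
    rw [h1]
    simp only [ModelWithCorners.range_eq_univ, mfderivWithin_univ]
    simp [extChartAt]
    rfl
  set t : Set E6 := (extChartAt (𝓡 6) x).symm ⁻¹' Set.univ ∩ Set.range (𝓡 6) with ht
  have h := (Filter.EventuallyEq.lieBracketWithin_vectorField_eq_of_mem (𝕜 := ℝ) (s := t)
    ((hc a).filter_mono nhdsWithin_le_nhds) ((hc b).filter_mono nhdsWithin_le_nhds)
    (by simp [ht])).trans
    (by simp [lieBracketWithin] :
      lieBracketWithin ℝ (fun _ => a) (fun _ => b) t (extChartAt (𝓡 6) x x) = 0)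
  rw [← mlieBracketWithin_univ, mlieBracketWithin_apply]
  exact (congrArg _ h).trans (map_zero _)

end CoordField

section ExtDeriv

variable {M : Type*} [TopologicalSpace M] [ChartedSpace E6 M] [IsManifold (𝓡 6) ∞ M]
  [RiemannianBundle (fun x : M => TangentSpace (𝓡 6) x)]
  [IsContMDiffRiemannianBundle (𝓡 6) ∞ E6 (fun x : M => TangentSpace (𝓡 6) x)]
  {D : CovariantDerivative (𝓡 6) E6 (fun x : M => TangentSpace (𝓡 6) x)}

set_option synthInstance.maxHeartbeats 400000 in
/-- The exterior derivative of the one-form dual to a vector field is twice the skew part of its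
covariant derivative. -/
theorem IsLeviCivita.extDerivOneForm_eq (hD : IsLeviCivita D)
    {α : ∀ x : M, TangentSpace (𝓡 6) x →L[ℝ] ℝ} (hα : SmoothOneForm α)
    {X : ∀ x : M, TangentSpace (𝓡 6) x} (hX : SmoothField X)
    (hXα : ∀ x (v : TangentSpace (𝓡 6) x), α x v = inner ℝ (X x) v)
    (x : M) (v w : TangentSpace (𝓡 6) x) :
    extDerivOneForm α x v w = inner ℝ (D X x v) w - inner ℝ (D X x w) v := by
  set c := chartAt E6 x with hc
  have hxc : x ∈ c.source := mem_chart_source E6 x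
  have hder : ∀ v w : TangentSpace (𝓡 6) x,
      fderiv ℝ (oneFormInChart α x) (c x) (mvfderiv (𝓡 6) c x v) (mvfderiv (𝓡 6) c x w)
      = inner ℝ (D X x v) w
        + inner ℝ (X x) (D (coordField x (mvfderiv (𝓡 6) c x w)) x v) := by
    intro v w
    set a : E6 := mvfderiv (𝓡 6) c x w with ha
    have hd := differentiableAt_oneFormInChart hα x
    have hda : DifferentiableAt ℝ (fun y => oneFormInChart α x y a) (c x) :=
      hd.clm_apply (by fun_prop)
    have h1 : fderiv ℝ (oneFormInChart α x) (c x) (mvfderiv (𝓡 6) c x v) a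
        = fderiv ℝ (fun y => oneFormInChart α x y a) (c x) (mvfderiv (𝓡 6) c x v) := by
      rw [fderiv_clm_apply hd (by fun_prop)]
      simp [hc]
    have h2 := mfderiv_comp (I' := 𝓡 6) (I'' := 𝓘(ℝ, ℝ)) x hda.mdifferentiableAt
      (mdifferentiableAt_atlas (I := 𝓡 6) (chart_mem_atlas E6 x) hxc)
    have h3 : mfderiv (𝓡 6) 𝓘(ℝ, ℝ) ((fun y => oneFormInChart α x y a) ∘ c) x
        = mfderiv (𝓡 6) 𝓘(ℝ, ℝ) (fun z => (inner ℝ (X z) (coordField x a z) : ℝ)) x := by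
      apply Filter.EventuallyEq.mfderiv_eq
      filter_upwards [c.open_source.mem_nhds hxc] with z hz
      have hcongr : ∀ {z z' : M} (_ : z = z') (b : E6),
          (show E6 →L[ℝ] ℝ from α z) b = (show E6 →L[ℝ] ℝ from α z') b := by
        rintro z _ rfl b; rfl
      rw [← hXα]
      exact hcongr (c.left_inv hz) _
    have h4 := hD.metric.mvfderiv_inner_eq (fun _ => v) (hX.mdifferentiableAt x)
      (mdifferentiableAt_coordField x a)
    have h5 : coordField x a x = w := coordField_self x w
    simp only [h5] at h4
    rw [h1, ← h4]
    rw [h3] at h2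
    rw [mfderiv_eq_fderiv] at h2
    exact (DFunLike.congr_fun h2 v).symm
  have hbr := D.torsion_eq_zero_iff.mp hD.torsion_free
    (mdifferentiableAt_coordField x (mvfderiv (𝓡 6) c x v))
    (mdifferentiableAt_coordField x (mvfderiv (𝓡 6) c x w))
  rw [mlieBracket_coordField, coordField_self, coordField_self, sub_eq_zero] at hbr
  rw [extDerivOneForm_eq_sub hα, ← hc, hder, hder, hbr]
  ring

end ExtDeriv

/-! ### Tensorial one-forms on a principal bundle with abelian structure group -/

section Descent

variable {M : Type*} [TopologicalSpace M] [ChartedSpace E6 M] [IsManifold (𝓡 6) ∞ M]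
  {EK : Type*} [NormedAddCommGroup EK] [NormedSpace ℝ EK]
  {K : Type*} [TopologicalSpace K] [ChartedSpace EK K]
  {EP : Type*} [NormedAddCommGroup EP] [NormedSpace ℝ EP]
  {P : Type*} [TopologicalSpace P] [ChartedSpace EP P] [IsManifold 𝓘(ℝ, EP) ∞ P]

lemma adjointRep_eq_id [CommGroup K] (k : K) :
    adjointRep k = ContinuousLinearMap.id ℝ EK := by
  have h : (fun h : K => k * h * k⁻¹) = id := by
    ext h
    simp [mul_comm k h]
  rw [adjointRep, h, mfderiv_id]
  rfl

namespace PrincipalBundle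

section Group

variable [Group K] [LieGroup 𝓘(ℝ, EK) ∞ K] (B : PrincipalBundle M EK K EP P)

/-- There is a smooth local section through every point of the total space. -/
lemma exists_section (p : P) : ∃ (U : Set M) (s : M → P), IsOpen U ∧ B.proj p ∈ U ∧
    ContMDiffOn (𝓡 6) 𝓘(ℝ, EP) ∞ s U ∧ (∀ y ∈ U, B.proj (s y) = y) ∧ s (B.proj p) = p := by
  obtain ⟨U, s, κ, hU, hx, hs, -, hproj, -, hκ⟩ := B.locally_trivial (B.proj p)
  refine ⟨U, fun y => B.act (s y) (κ p), hU, hx, ?_, fun y hy => ?_, hκ p hx⟩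
  · exact B.contMDiff_act.comp_contMDiffOn (hs.prodMk contMDiffOn_const)
  · rw [B.proj_act, hproj y hy]

lemma mdifferentiable_proj : MDifferentiable 𝓘(ℝ, EP) (𝓡 6) B.proj :=
  B.contMDiff_proj.mdifferentiable (by simp)

lemma mfderiv_proj_section {U : Set M} (hU : IsOpen U) {s : M → P}
    (hs : ContMDiffOn (𝓡 6) 𝓘(ℝ, EP) ∞ s U) (hproj : ∀ y ∈ U, B.proj (s y) = y) {y : M}
    (hy : y ∈ U) (v : E6) :
    (mfderiv 𝓘(ℝ, EP) (𝓡 6) B.proj (s y) (mfderiv (𝓡 6) 𝓘(ℝ, EP) s y v) : E6) = v := by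
  have h1 := mfderiv_comp y (B.mdifferentiable_proj (s y))
    ((hs.contMDiffAt (hU.mem_nhds hy)).mdifferentiableAt (by simp))
  have h2 : mfderiv (𝓡 6) (𝓡 6) (B.proj ∘ s) y = mfderiv (𝓡 6) (𝓡 6) id y := by
    apply Filter.EventuallyEq.mfderiv_eq
    filter_upwards [hU.mem_nhds hy] with z hz
    exact hproj z hz
  rw [h1, mfderiv_id] at h2
  exact DFunLike.congr_fun h2 v

lemma surjective_mfderiv_proj (p : P) :
    Function.Surjective (mfderiv 𝓘(ℝ, EP) (𝓡 6) B.proj p) := by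
  intro v
  obtain ⟨U, s, hU, hx, hs, hproj, hsp⟩ := B.exists_section p
  have h := B.mfderiv_proj_section hU hs hproj hx v
  have key : ∀ {q : P} (_ : q = p) (u : EP),
      (mfderiv 𝓘(ℝ, EP) (𝓡 6) B.proj q u : E6) = mfderiv 𝓘(ℝ, EP) (𝓡 6) B.proj p u := by
    rintro q rfl u; rfl
  exact ⟨_, (key hsp _).symm.trans h⟩

lemma mfderiv_proj_fundamental (p : P) (ξ : EK) :
    mfderiv 𝓘(ℝ, EP) (𝓡 6) B.proj p (B.fundamental p ξ) = 0 := by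
  have hact : MDifferentiableAt 𝓘(ℝ, EK) 𝓘(ℝ, EP) (fun k : K => B.act p k) 1 :=
    (B.contMDiff_act.comp (contMDiff_const.prodMk contMDiff_id)).mdifferentiable (by simp) 1
  have h1 := mfderiv_comp (1 : K) (B.mdifferentiable_proj (B.act p 1)) hact
  have h2 : B.proj ∘ (fun k : K => B.act p k) = fun _ => B.proj p := by
    ext k
    exact B.proj_act p k
  rw [h2, mfderiv_const] at h1
  have key : ∀ {q : P} (_ : q = p) (u : EP),
      (mfderiv 𝓘(ℝ, EP) (𝓡 6) B.proj q u : E6) = mfderiv 𝓘(ℝ, EP) (𝓡 6) B.proj p u := by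
    rintro q rfl u; rfl
  exact (key (B.act_one p) _).symm.trans (DFunLike.congr_fun h1 ξ).symm

variable {B}

lemma Connection.mfderiv_proj_lift (A : B.Connection) (p : P)
    (v : TangentSpace (𝓡 6) (B.proj p)) :
    mfderiv 𝓘(ℝ, EP) (𝓡 6) B.proj p (A.lift p v) = v := by
  rw [Connection.lift, Connection.horPart, map_sub, B.mfderiv_proj_fundamental, sub_zero]
  exact Function.rightInverse_invFun (B.surjective_mfderiv_proj p) v

end Group

section CommGroup

variable [CommGroup K] [LieGroup 𝓘(ℝ, EK) ∞ K] {B : PrincipalBundle M EK K EP P}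

/-- For an abelian structure group a tensorial one-form is determined by the projections to the
base of the point and of the tangent vector: equivariance is invariance. -/
lemma AdOneForm.form_eq_of_proj_eq (ε : B.AdOneForm) {p p' : P} (hp : B.proj p = B.proj p')
    (u : TangentSpace 𝓘(ℝ, EP) p) (u' : TangentSpace 𝓘(ℝ, EP) p')
    (hu : (mfderiv 𝓘(ℝ, EP) (𝓡 6) B.proj p u : E6) = mfderiv 𝓘(ℝ, EP) (𝓡 6) B.proj p' u') :
    ε.form p u = ε.form p' u' := by
  obtain ⟨U, s, κ, hU, hx, -, -, -, -, hκ⟩ := B.locally_trivial (B.proj p)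
  -- the structure group acts transitively on the fibres
  obtain ⟨k, rfl⟩ : ∃ k, p' = B.act p k := by
    refine ⟨(κ p)⁻¹ * κ p', ?_⟩
    have h1 := hκ p hx
    have h2 := hκ p' (by rw [Set.mem_preimage, ← hp]; exact hx)
    have h3 := B.act_mul (s (B.proj p)) (κ p) ((κ p)⁻¹ * κ p')
    rwa [h1, mul_inv_cancel_left, hp, h2] at h3
  have h1 := ε.equivariant p k u
  rw [adjointRep_eq_id] at h1
  have hact : MDifferentiableAt 𝓘(ℝ, EP) 𝓘(ℝ, EP) (fun q : P => B.act q k) p :=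
    (B.contMDiff_act.comp (contMDiff_id.prodMk contMDiff_const)).mdifferentiable (by simp) p
  have h2 := mfderiv_comp p (B.mdifferentiable_proj (B.act p k)) hact
  have h3 : B.proj ∘ (fun q : P => B.act q k) = B.proj := by
    ext q
    exact B.proj_act q k
  rw [h3] at h2
  have h4 := ε.horizontal (B.act p k)
    (u' - mfderiv 𝓘(ℝ, EP) 𝓘(ℝ, EP) (fun q => B.act q k) p u) (by
      rw [map_sub, sub_eq_zero]
      exact hu.symm.trans (DFunLike.congr_fun h2 u))
  rw [map_sub, sub_eq_zero, h1] at h4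
  exact h4.symm

/-- For an abelian structure group a tensorial one-form is the pull-back of a smooth one-form on
the base. -/
theorem AdOneForm.exists_eq_pullback (ε : B.AdOneForm) :
    ∃ α : ∀ x : M, TangentSpace (𝓡 6) x →L[ℝ] EK, SmoothOneForm (EP := E6) α ∧
      ∀ p (u : TangentSpace 𝓘(ℝ, EP) p),
        ε.form p u = α (B.proj p) (mfderiv 𝓘(ℝ, EP) (𝓡 6) B.proj p u) := by
  choose U s κ hU hx hs _ hproj _ _ using B.locally_trivial
  refine ⟨fun x => (ε.form (s x x)).comp (mfderiv (𝓡 6) 𝓘(ℝ, EP) (s x) x), ?_, ?_⟩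
  · intro w
    have h := ε.smooth.contMDiffOn_pullback (hU w.1) (hs w.1)
    have hopen : IsOpen (π E6 (TangentSpace (𝓡 6)) ⁻¹' U w.1 : Set (TangentBundle (𝓡 6) M)) :=
      (hU w.1).preimage (FiberBundle.continuous_proj E6 (TangentSpace (𝓡 6)))
    have hmem := hopen.mem_nhds (show w ∈ _ from hx w.1)
    refine (h.contMDiffAt hmem).congr_of_eventuallyEq ?_
    filter_upwards [hmem] with z hz
    refine ε.form_eq_of_proj_eq ((hproj _ _ (hx z.1)).trans (hproj _ _ hz).symm) _ _ ?_
    exact (B.mfderiv_proj_section (hU _) (hs _) (hproj _) (hx z.1) z.2).trans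
      (B.mfderiv_proj_section (hU _) (hs _) (hproj _) hz z.2).symm
  · intro p u
    refine ε.form_eq_of_proj_eq (hproj _ _ (hx _)).symm _ _ ?_
    exact (B.mfderiv_proj_section (hU _) (hs _) (hproj _) (hx (B.proj p)) _).symm

/-- The exterior covariant derivative of a tensorial one-form in terms of the form on the base. -/
lemma Connection.extCovDeriv_eq [FiniteDimensional ℝ EP] (A : B.Connection) (ε : B.AdOneForm)
    {α : ∀ x : M, TangentSpace (𝓡 6) x →L[ℝ] EK} (hα : SmoothOneForm (EP := E6) α)
    (hεα : ∀ p (u : TangentSpace 𝓘(ℝ, EP) p),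
      ε.form p u = α (B.proj p) (mfderiv 𝓘(ℝ, EP) (𝓡 6) B.proj p u))
    (p : P) (v w : TangentSpace (𝓡 6) (B.proj p)) :
    A.extCovDeriv ε.form p v w = extDerivOneForm α (B.proj p) v w := by
  have h : ε.form = fun q => (α (B.proj q)).comp (mfderiv 𝓘(ℝ, EP) (𝓡 6) B.proj q) := by
    ext q u
    exact hεα q u
  rw [Connection.extCovDeriv, h, extDerivOneForm_pullback hα B.contMDiff_proj,
    A.mfderiv_proj_lift, A.mfderiv_proj_lift]

/-- The covariant derivative of a tensorial one-form in terms of the form on the base. -/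
lemma Connection.covDeriv_eq (A : B.Connection) (ε : B.AdOneForm)
    {α : ∀ x : M, TangentSpace (𝓡 6) x →L[ℝ] EK} (hα : SmoothOneForm (EP := E6) α)
    (hεα : ∀ p (u : TangentSpace 𝓘(ℝ, EP) p),
      ε.form p u = α (B.proj p) (mfderiv 𝓘(ℝ, EP) (𝓡 6) B.proj p u))
    (D : CovariantDerivative (𝓡 6) E6 (fun x : M => TangentSpace (𝓡 6) x))
    {Y : ∀ x : M, TangentSpace (𝓡 6) x} (hY : SmoothField Y)
    (p : P) (v : TangentSpace (𝓡 6) (B.proj p)) :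
    A.covDeriv D ε Y p v
      = mvfderiv (𝓡 6) (fun y => α y (Y y)) (B.proj p) v
        - α (B.proj p) (D Y (B.proj p) v) := by
  have hf : ContMDiff (𝓡 6) 𝓘(ℝ, EK) ∞ (fun y => α y (Y y)) := hα.comp hY
  have h : (fun q : P => ε.form q (A.lift q (Y (B.proj q))))
      = (fun y => α y (Y y)) ∘ B.proj := by
    ext q
    rw [hεα, A.mfderiv_proj_lift]
    rfl
  have h1 := mfderiv_comp p (hf.mdifferentiable (by simp) _) (B.mdifferentiable_proj p)
  rw [Connection.covDeriv, h, hεα, A.mfderiv_proj_lift]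
  congr 1
  have h2 := DFunLike.congr_fun h1 (A.lift p v)
  refine h2.trans ?_
  exact congrArg (mfderiv (𝓡 6) 𝓘(ℝ, EK) (fun y => α y (Y y)) (B.proj p))
    (A.mfderiv_proj_lift p v)

end CommGroup

end PrincipalBundle

end Descent

/-! ### The Dirac equation for an infinitesimal deformation -/

section Deformation

variable {M : Type*} [TopologicalSpace M] [ChartedSpace E6 M] [IsManifold (𝓡 6) ∞ M]
  [RiemannianBundle (fun x : M => TangentSpace (𝓡 6) x)]
  [IsContMDiffRiemannianBundle (𝓡 6) ∞ E6 (fun x : M => TangentSpace (𝓡 6) x)]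
  {S : M → Type*} [TopologicalSpace (Bundle.TotalSpace E8 S)]
  [∀ x, NormedAddCommGroup (S x)] [∀ x, InnerProductSpace ℝ (S x)]
  [FiberBundle E8 S] [VectorBundle ℝ E8 S] [ContMDiffVectorBundle ∞ E8 S (𝓡 6)]
  [IsContMDiffRiemannianBundle (𝓡 6) ∞ E8 S]

/-- The vector field dual to a smooth real one-form. -/
lemma exists_smoothField_dual [T2Space M] {α : ∀ x : M, TangentSpace (𝓡 6) x →L[ℝ] ℝ}
    (hα : SmoothOneForm (EP := E6) α) :
    ∃ X : ∀ x : M, TangentSpace (𝓡 6) x, SmoothField X ∧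
      ∀ x (v : TangentSpace (𝓡 6) x), α x v = inner ℝ (X x) v := by
  have hframe : ∀ x (e : OrthonormalBasis (Fin 6) ℝ (TangentSpace (𝓡 6) x))
      (v : TangentSpace (𝓡 6) x), α x v = inner ℝ (∑ a, α x (e a) • e a) v := by
    intro x e v
    conv_lhs => rw [← e.sum_repr' v]
    simp only [map_sum, map_smul, smul_eq_mul, sum_inner, real_inner_smul_left]
    exact Finset.sum_congr rfl fun a _ => mul_comm _ _
  choose E U hE hU hx hEU using fun x₀ : M => exists_orthonormal_frame x₀
  refine ⟨fun x => ∑ a, α x (E x a x) • E x a x, ?_, ?_⟩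
  · intro x₀
    have h : SmoothField (fun x => ∑ a, α x (E x₀ a x) • E x₀ a x) :=
      ContMDiff.sum_section fun a _ =>
        ContMDiff.smul_section (f := fun x => α x (E x₀ a x)) (hα.comp (hE x₀ a)) (hE x₀ a)
    refine (h x₀).congr_of_eventuallyEq ?_
    filter_upwards [(hU x₀).mem_nhds (hx x₀)] with x hxU
    obtain ⟨e, he⟩ := exists_orthonormalBasis_of_orthonormal (hEU x x (hx x))
    obtain ⟨e', he'⟩ := exists_orthonormalBasis_of_orthonormal (hEU x₀ x hxU)
    have : ∑ a, α x (e a) • e a = ∑ a, α x (e' a) • e' a :=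
      ext_inner_right ℝ fun v => (hframe x e v).symm.trans (hframe x e' v)
    simp only [he, he'] at this
    rw [this]
  · intro x v
    obtain ⟨e, he⟩ := exists_orthonormalBasis_of_orthonormal (hEU x x (hx x))
    have := hframe x e v
    simpa only [he] using this

namespace NearlyKahler

variable (N : NearlyKahler M S)

/-- A vector field `X` with `dX♭ · ψ = 0` and `div X = 0` vanishes on a compact nearly Kähler
manifold: by the Killing equation `X · ψ` is an eigenspinor of the Dirac operator, with the
eigenvalue `4 λ`. -/
theorem eq_zero_of_divergence_free [T2Space M] [CompactSpace M]
    {X : ∀ x : M, TangentSpace (𝓡 6) x} (hX : SmoothField X)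
    (hdiv : ∀ x (e : OrthonormalBasis (Fin 6) ℝ (TangentSpace (𝓡 6) x)),
      ∑ a, (inner ℝ (N.LC X x (e a)) (e a) : ℝ) = 0)
    (hcurl : ∀ x (e : OrthonormalBasis (Fin 6) ℝ (TangentSpace (𝓡 6) x)),
      ∑ a, ∑ b, (inner ℝ (N.LC X x (e a)) (e b) - inner ℝ (N.LC X x (e b)) (e a) : ℝ) •
        N.spin.cl x (e a) (N.spin.cl x (e b) (N.ψ x)) = 0) (x : M) : X x = 0 := by
  have hψ : SmoothSection E8 N.ψ := N.contMDiff_ψ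
  have hφ := N.eq_zero_of_dirac (N.spin.smoothSection_cl hX hψ) ?_ x
  · have h := N.spin.cl_cl x (X x) (N.ψ x)
    rw [hφ, map_zero] at h
    have h2 := (smul_eq_zero.mp h.symm).resolve_right (N.ψ_ne_zero x)
    exact inner_self_eq_zero.mp (neg_eq_zero.mp h2)
  · intro x e
    have he := N.spin.isCliffordFrame e.orthonormal
    set ψ := N.ψ x with hψx
    have h1 : ∀ b, N.spinLC (fun y => N.spin.cl y (X y) (N.ψ y)) x (e b)
        = ∑ c, N.spin.cl x (e c) ((inner ℝ (N.LC X x (e b)) (e c) : ℝ) • ψ)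
          + N.lam • ∑ c, (inner ℝ (e c) (X x) : ℝ) •
            N.spin.cl x (e c) (N.spin.cl x (e b) ψ) := by
      intro b
      rw [N.isSpinConnection.cov_cl hX hψ, N.killing]
      conv_lhs => rw [← e.sum_repr' (N.LC X x (e b)), ← e.sum_repr' (X x)]
      simp only [map_sum, map_smul, sum_apply, smul_apply, Finset.smul_sum,
        real_inner_comm (N.LC X x (e b)), smul_comm N.lam, hψx]
    have h2 := he.sum_mul_mul_eq fun a b => (inner ℝ (N.LC X x (e a)) (e b) : ℝ) • ψ
    simp only [← sub_smul, ContinuousLinearMap.coe_coe, map_smul] at h2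
    rw [hcurl x e, ← Finset.sum_smul, hdiv x e, zero_smul, smul_zero, neg_zero, add_zero] at h2
    have h3 : ∀ c, ∑ b, N.spin.cl x (e b) (N.spin.cl x (e c) (N.spin.cl x (e b) ψ))
        = (4 : ℝ) • N.spin.cl x (e c) ψ := fun c => he.sum_mul_mul_mul c ψ
    simp only [h1, map_add, map_sum, map_smul, Finset.sum_add_distrib]
    rw [h2, zero_add, ← Finset.smul_sum, Finset.sum_comm]
    simp only [← Finset.smul_sum, h3]
    conv_rhs => rw [← e.sum_repr' (X x)]
    simp only [map_sum, map_smul, sum_apply, smul_apply, Finset.smul_sum, smul_smul]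
    refine Finset.sum_congr rfl fun c _ => ?_
    congr 1
    ring

end NearlyKahler

end Deformation

end

theorem mainTheorem2
    {M : Type*} [TopologicalSpace M] [T2Space M] [CompactSpace M]
    [ChartedSpace E6 M] [IsManifold (𝓡 6) ∞ M]
    [RiemannianBundle (fun x : M => TangentSpace (𝓡 6) x)]
    [IsContMDiffRiemannianBundle (𝓡 6) ∞ E6 (fun x : M => TangentSpace (𝓡 6) x)]
    {S : M → Type*} [TopologicalSpace (Bundle.TotalSpace E8 S)]
    [∀ x, NormedAddCommGroup (S x)] [∀ x, InnerProductSpace ℝ (S x)]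
    [FiberBundle E8 S] [VectorBundle ℝ E8 S] [ContMDiffVectorBundle ∞ E8 S (𝓡 6)]
    [IsContMDiffRiemannianBundle (𝓡 6) ∞ E8 S]
    (N : NearlyKahler M S)
    {EK : Type*} [NormedAddCommGroup EK] [NormedSpace ℝ EK] [FiniteDimensional ℝ EK]
    {K : Type*} [TopologicalSpace K] [ChartedSpace EK K] [CommGroup K]
    [LieGroup 𝓘(ℝ, EK) ∞ K]
    {EP : Type*} [NormedAddCommGroup EP] [NormedSpace ℝ EP] [FiniteDimensional ℝ EP]
    {P : Type*} [TopologicalSpace P] [ChartedSpace EP P] [IsManifold 𝓘(ℝ, EP) ∞ P]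
    (B : PrincipalBundle M EK K EP P) (A : B.Connection) (hA : IsInstanton N A) :
    IsRigid N A := by
  intro ε hlin hgauge p
  obtain ⟨α, hα, hεα⟩ := ε.exists_eq_pullback
  -- it is enough to treat the real components of the form on the base
  suffices h : ∀ (l : EK →L[ℝ] ℝ) x (v : TangentSpace (𝓡 6) x), l (α x v) = 0 by
    ext u
    rw [hεα]
    exact SeparatingDual.eq_zero_of_forall_dual_eq_zero (R := ℝ) fun l => h l _ _
  intro l x v
  have hlα : SmoothOneForm (EP := E6) (fun x => l.comp (α x)) := l.contMDiff.comp hα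
  obtain ⟨X, hX, hXα⟩ := exists_smoothField_dual hlα
  have hXα' : ∀ x (v : TangentSpace (𝓡 6) x), l (α x v) = inner ℝ (X x) v := hXα
  have hproj : ∀ x : M, ∃ p : P, B.proj p = x := by
    intro x
    obtain ⟨U, s, κ, -, hx, -, -, hs, -⟩ := B.locally_trivial x
    exact ⟨s x, hs x hx⟩
  have hX0 := N.eq_zero_of_divergence_free hX ?_ ?_ x
  · rw [hXα', hX0, inner_zero_left]
  · intro x e
    obtain ⟨p, rfl⟩ := hproj x
    choose Y hY hYx using fun a => exists_smoothSection_eq (F := E6)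
      (V := fun x : M => TangentSpace (𝓡 6) x) (B.proj p) (e a)
    have h := hgauge p Y (fun a => hY a _) (by simp only [hYx]; exact e.orthonormal)
    have h1 : ∀ a, l (A.covDeriv N.LC ε (Y a) p (Y a (B.proj p)))
        = inner ℝ (N.LC X (B.proj p) (e a)) (e a) := by
      intro a
      have hf : ContMDiff (𝓡 6) 𝓘(ℝ, EK) ∞ (fun y => α y (Y a y)) := hα.comp (hY a)
      have h2 := mfderiv_comp (B.proj p) (l.contMDiff (n := ∞).mdifferentiable (by simp) _)
        (hf.mdifferentiable (by simp) (B.proj p))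
      have h3 : l ∘ (fun y => α y (Y a y)) = fun y => (inner ℝ (X y) (Y a y) : ℝ) := by
        ext y
        exact hXα' y _
      have h4 := mvfderiv_inner N.isLeviCivita.metric hX (hY a) (Y := Y a) (B.proj p)
      rw [h3] at h2
      have h5 : l (mvfderiv (𝓡 6) (fun y => α y (Y a y)) (B.proj p) (Y a (B.proj p)))
          = mvfderiv (𝓡 6) (fun y => (inner ℝ (X y) (Y a y) : ℝ)) (B.proj p)
            (Y a (B.proj p)) := by
        rw [mfderiv_eq_fderiv, l.fderiv] at h2
        exact (DFunLike.congr_fun h2 (Y a (B.proj p))).symm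
      rw [A.covDeriv_eq ε hα hεα N.LC (hY a), map_sub, hXα', h5, h4, add_sub_cancel_right, hYx]
    simp only [← h1, ← map_sum]
    rw [h, map_zero]
  · intro x e
    obtain ⟨p, rfl⟩ := hproj x
    have h := congrArg (fun t => TensorProduct.lid ℝ (S (B.proj p))
      (l.toLinearMap.rTensor (S (B.proj p)) t)) (hlin p e)
    have h1 : ∀ v w, l (A.extCovDeriv ε.form p v w)
        = inner ℝ (N.LC X (B.proj p) v) w - inner ℝ (N.LC X (B.proj p) w) v := by
      intro v w
      rw [A.extCovDeriv_eq ε hα hεα, ← extDerivOneForm_clm_comp l hα,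
        N.isLeviCivita.extDerivOneForm_eq hlα hX hXα]
    simpa [clTwoForm, h1] using h
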